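/- Let $M$ be a connected complete (smooth, boundaryless, finite-dimensional) Riemannian manifold with Riemannian distance $d$, let $T:M\to M$ be Lipschitz with respect to $d$, and let $\mu$ be an ergodic $T$-invariant Borel probability measure on $M$. For $x\in M$, $n\ge 1$ and $r>0$ put $$B_n(x,r)=\{y\in M: d(T^i x,T^i y)<r \text{ for all } 0\le i\le n-1\}.$$ Then $$h_\mu(T)=\sup_{K}\ \operatorname*{ess\,sup}_{x\in K}\ \lim_{r\to 0}\ \liminf_{n\to\infty}\ -\frac1n\log\mu(B_n(x,r)),$$ where the supremum is over all compact $K\subset M$ with $\mu(K)>0$, the essential supremum is taken with respect to $\mu$, and $-\log 0=+\infty$. Here $h_\mu(T)$ is the measure-theoretic entropy, i.e. $$h_\mu(T)=\sup_{\mathcal P}\ \lim_{n\to\infty}\frac1n H_\mu(\mathcal P^n),\qquad H_\mu(\mathcal Q)=-\sum_{Q\in\mathcal Q}\mu(Q)\log\mu(Q)\quad(0\log 0=0),$$ where $\mathcal P$ ranges over all finite measurable partitions of $M$ and $\mathcal P^n$ is the partition into the intersections $\bigcap_{i=0}^{n-1}T^{-i}P_i$ with $P_i\in\mathcal P$. 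-/

import Mathlib

open MeasureTheory Filter Set
open scoped Topology NNReal ENNReal ContDiff Manifold Bundle

noncomputable section

/-- A finite measurable partition of `X`, with its atoms labelled by `Fin k`. Atoms may be empty;
empty atoms contribute nothing to the entropy. -/
structure FinMeasurablePartition (X : Type*) [MeasurableSpace X] (k : ℕ) where
  atom : Fin k → Set X
  measurableSet_atom : ∀ j, MeasurableSet (atom j)
  disjoint_atom : Pairwise fun i j => Disjoint (atom i) (atom j)
  iUnion_atom : ⋃ j, atom j = univ

/-- The element of the refined partition `𝒫ⁿ` with itinerary `w`: the intersection of the sets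
`T⁻ⁱ P_{w i}`, `0 ≤ i ≤ n - 1`. -/
def refinedAtom {X : Type*} [MeasurableSpace X] {k : ℕ} (T : X → X)
    (P : FinMeasurablePartition X k) (n : ℕ) (w : Fin n → Fin k) : Set X :=
  ⋂ i : Fin n, T^[(i : ℕ)] ⁻¹' P.atom (w i)

/-- The entropy `H_μ(𝒫ⁿ) = - ∑ μ(A) log μ(A)`, the sum being over the atoms `A` of `𝒫ⁿ`
(with `0 log 0 = 0`). -/
def refinedEntropy {X : Type*} [MeasurableSpace X] {k : ℕ} (μ : Measure X) (T : X → X)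
    (P : FinMeasurablePartition X k) (n : ℕ) : ℝ :=
  ∑ w : Fin n → Fin k, Real.negMulLog (μ.real (refinedAtom T P n w))

/-- The entropy `h_μ(T, 𝒫) = lim_{n → ∞} H_μ(𝒫ⁿ) / n`. It is written as an upper limit; the limit
exists as soon as `T` preserves `μ`, see `tendsto_partitionEntropy`. -/
def partitionEntropy {X : Type*} [MeasurableSpace X] {k : ℕ} (μ : Measure X) (T : X → X)
    (P : FinMeasurablePartition X k) : EReal :=
  limsup (fun n : ℕ => ((refinedEntropy μ T P n / n : ℝ) : EReal)) atTop

/-- The measure-theoretic entropy `h_μ(T)`: the supremum of `h_μ(T, 𝒫)` over all finite measurable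
partitions `𝒫`. -/
def measureEntropy {X : Type*} [MeasurableSpace X] (μ : Measure X) (T : X → X) : EReal :=
  ⨆ (k : ℕ) (P : FinMeasurablePartition X k), partitionEntropy μ T P

/-- The dynamical ball `B_n(x, r)`. -/
def dynBall {X : Type*} [MetricSpace X] (T : X → X) (n : ℕ) (x : X) (r : ℝ) : Set X :=
  {y | ∀ i < n, dist (T^[i] x) (T^[i] y) < r}

/-- `liminf_{n → ∞} - (1 / n) log μ(B_n(x, r))`, with `- log 0 = ∞`. -/
def ballDecay {X : Type*} [MetricSpace X] [MeasurableSpace X] (μ : Measure X) (T : X → X)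
    (x : X) (r : ℝ) : EReal :=
  liminf (fun n : ℕ => -(ENNReal.log (μ (dynBall T n x r)) / (n : EReal))) atTop

/-- The lower local entropy at `x`: the limit, as `r → 0⁺`, of
`liminf_{n → ∞} - (1 / n) log μ(B_n(x, r))`. It is written as an upper limit; the limit always
exists, see `tendsto_lowerLocalEntropy`. -/
def lowerLocalEntropy {X : Type*} [MetricSpace X] [MeasurableSpace X] (μ : Measure X) (T : X → X)
    (x : X) : EReal :=
  limsup (fun r : ℝ => ballDecay μ T x r) (𝓝[>] 0)

theorem ballDecay_antitone {X : Type*} [MetricSpace X] [MeasurableSpace X] (μ : Measure X)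
    (T : X → X) (x : X) : Antitone (ballDecay μ T x) := by
  intro r s hrs
  refine liminf_le_liminf (Eventually.of_forall fun n => ?_)
  refine EReal.neg_le_neg_iff.2 (EReal.div_le_div_right_of_nonneg (by positivity) ?_)
  exact ENNReal.log_monotone (measure_mono fun y hy i hi => (hy i hi).trans_le hrs)

theorem tendsto_lowerLocalEntropy {X : Type*} [MetricSpace X] [MeasurableSpace X] (μ : Measure X)
    (T : X → X) (x : X) :
    Tendsto (ballDecay μ T x) (𝓝[>] 0) (𝓝 (lowerLocalEntropy μ T x)) := by
  have h := (ballDecay_antitone μ T x).tendsto_nhdsGT 0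
  rw [lowerLocalEntropy, h.limsup_eq]
  exact h

theorem measurableSet_refinedAtom {X : Type*} [MeasurableSpace X] {k : ℕ} {T : X → X}
    (hT : Measurable T) (P : FinMeasurablePartition X k) (n : ℕ) (w : Fin n → Fin k) :
    MeasurableSet (refinedAtom T P n w) :=
  MeasurableSet.iInter fun i => (hT.iterate i) (P.measurableSet_atom _)

theorem refinedAtom_disjoint {X : Type*} [MeasurableSpace X] {k : ℕ} (T : X → X)
    (P : FinMeasurablePartition X k) (n : ℕ) :
    Pairwise fun v w => Disjoint (refinedAtom T P n v) (refinedAtom T P n w) := by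
  intro v w hvw
  obtain ⟨i, hi⟩ := Function.ne_iff.1 hvw
  refine Set.disjoint_left.2 fun x hx hy => ?_
  exact Set.disjoint_left.1 (P.disjoint_atom hi) (Set.mem_iInter.1 hx i) (Set.mem_iInter.1 hy i)

theorem iUnion_refinedAtom {X : Type*} [MeasurableSpace X] {k : ℕ} (T : X → X)
    (P : FinMeasurablePartition X k) (n : ℕ) : ⋃ w, refinedAtom T P n w = univ := by
  refine Set.eq_univ_of_forall fun x => ?_
  have h : ∀ y, ∃ j, y ∈ P.atom j := fun y => by
    have : y ∈ ⋃ j, P.atom j := by rw [P.iUnion_atom]; trivial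
    exact Set.mem_iUnion.1 this
  choose c hc using h
  exact Set.mem_iUnion.2 ⟨fun i => c (T^[(i : ℕ)] x), Set.mem_iInter.2 fun i => hc _⟩

theorem refinedAtom_append {X : Type*} [MeasurableSpace X] {k : ℕ} (T : X → X)
    (P : FinMeasurablePartition X k) (m n : ℕ) (u : Fin m → Fin k) (v : Fin n → Fin k) :
    refinedAtom T P (m + n) (Fin.append u v) =
      refinedAtom T P m u ∩ T^[m] ⁻¹' refinedAtom T P n v := by
  ext x
  simp only [refinedAtom, Set.mem_iInter, Set.mem_inter_iff, Set.mem_preimage]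
  constructor
  · intro h
    refine ⟨fun i => ?_, fun i => ?_⟩
    · simpa using h (Fin.castAdd n i)
    · have := h (Fin.natAdd m i)
      rwa [Fin.append_right, Fin.val_natAdd, add_comm, Function.iterate_add_apply] at this
  · rintro ⟨h1, h2⟩ i
    refine Fin.addCases (fun i => ?_) (fun i => ?_) i
    · simpa using h1 i
    · rw [Fin.append_right, Fin.val_natAdd, add_comm, Function.iterate_add_apply]
      exact h2 i

theorem sum_measureReal_inter {X ι : Type*} [MeasurableSpace X] [Fintype ι] (μ : Measure X)
    [IsProbabilityMeasure μ] (B : ι → Set X) (hB : ∀ i, MeasurableSet (B i))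
    (hd : Pairwise fun i j => Disjoint (B i) (B j)) (hU : ⋃ i, B i = univ) (A : Set X)
    (hA : MeasurableSet A) : ∑ i, μ.real (A ∩ B i) = μ.real A := by
  rw [← measureReal_iUnion_fintype (fun i j hij => (hd hij).mono inter_subset_right
    inter_subset_right) (fun i => hA.inter (hB i)), ← Set.inter_iUnion, hU, Set.inter_univ]

/-- Subadditivity of the Shannon entropy of a joint distribution `p`. -/
theorem sum_negMulLog_le {α β : Type*} [Fintype α] [Fintype β] (p : α → β → ℝ) (a : α → ℝ)
    (b : β → ℝ) (hp : ∀ u v, 0 ≤ p u v) (ha : ∀ u, ∑ v, p u v = a u)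
    (hb : ∀ v, ∑ u, p u v = b v) (h1 : ∑ u, a u = 1) :
    ∑ u, ∑ v, Real.negMulLog (p u v) ≤
      ∑ u, Real.negMulLog (a u) + ∑ v, Real.negMulLog (b v) := by
  have key : ∀ u v, Real.negMulLog (p u v) ≤
      -(p u v * Real.log (a u)) - p u v * Real.log (b v) + (a u * b v - p u v) := by
    intro u v
    have hau : p u v ≤ a u := by
      rw [← ha u]
      exact Finset.single_le_sum (f := fun v => p u v) (fun v _ => hp u v) (Finset.mem_univ v)
    have hbv : p u v ≤ b v := by
      rw [← hb v]
      exact Finset.single_le_sum (f := fun u => p u v) (fun u _ => hp u v) (Finset.mem_univ u)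
    rcases (hp u v).eq_or_lt with h | h
    · rw [← h] at hau hbv ⊢
      simpa using mul_nonneg hau hbv
    · have hA : 0 < a u := h.trans_le hau
      have hB : 0 < b v := h.trans_le hbv
      have hl := Real.log_le_sub_one_of_pos (div_pos (mul_pos hA hB) h)
      rw [Real.log_div (mul_pos hA hB).ne' h.ne', Real.log_mul hA.ne' hB.ne'] at hl
      have h2 := mul_le_mul_of_nonneg_left hl h.le
      have h3 : p u v * (a u * b v / p u v - 1) = a u * b v - p u v := by
        field_simp
      rw [h3] at h2
      rw [Real.negMulLog]
      linarith
  have hpa : ∑ u, ∑ v, p u v = 1 := by simp_rw [ha, h1]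
  have hb1 : ∑ v, b v = 1 := by rw [← hpa, Finset.sum_comm]; simp_rw [hb]
  have e1 : ∑ u, ∑ v, p u v * Real.log (a u) = ∑ u, a u * Real.log (a u) := by
    simp_rw [← Finset.sum_mul, ha]
  have e2 : ∑ u, ∑ v, p u v * Real.log (b v) = ∑ v, b v * Real.log (b v) := by
    rw [Finset.sum_comm]; simp_rw [← Finset.sum_mul, hb]
  have e3 : ∑ u, ∑ v, a u * b v = 1 := by
    simp_rw [← Finset.mul_sum, hb1, mul_one, h1]
  calc ∑ u, ∑ v, Real.negMulLog (p u v)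
      ≤ ∑ u, ∑ v, (-(p u v * Real.log (a u)) - p u v * Real.log (b v)
          + (a u * b v - p u v)) :=
        Finset.sum_le_sum fun u _ => Finset.sum_le_sum fun v _ => key u v
    _ = ∑ u, Real.negMulLog (a u) + ∑ v, Real.negMulLog (b v) := by
        simp only [Finset.sum_add_distrib, Finset.sum_sub_distrib, Finset.sum_neg_distrib, e1, e2,
          e3, hpa, Real.negMulLog, neg_mul]
        ring

theorem refinedEntropy_subadditive {X : Type*} [MeasurableSpace X] {k : ℕ} (μ : Measure X)
    [IsProbabilityMeasure μ] {T : X → X} (hT : MeasurePreserving T μ μ)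
    (P : FinMeasurablePartition X k) : Subadditive (refinedEntropy μ T P) := by
  intro m n
  have hmeas := measurableSet_refinedAtom hT.measurable P
  have hpre : ∀ v, MeasurableSet (T^[m] ⁻¹' refinedAtom T P n v) := fun v =>
    (hT.measurable.iterate m) (hmeas n v)
  have hsum : refinedEntropy μ T P (m + n) = ∑ u : Fin m → Fin k, ∑ v : Fin n → Fin k,
      Real.negMulLog (μ.real (refinedAtom T P m u ∩ T^[m] ⁻¹' refinedAtom T P n v)) := by
    rw [refinedEntropy, ← (Fin.appendEquiv m n).sum_comp, Fintype.sum_prod_type]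
    refine Finset.sum_congr rfl fun u _ => Finset.sum_congr rfl fun v _ => ?_
    rw [← refinedAtom_append]
    rfl
  rw [hsum]
  refine sum_negMulLog_le _ _ _ (fun _ _ => measureReal_nonneg) (fun u => ?_) (fun v => ?_) ?_
  · refine sum_measureReal_inter μ _ hpre (fun v w h => ?_) ?_ _ (hmeas m u)
    · exact (refinedAtom_disjoint T P n h).preimage _
    · rw [← Set.preimage_iUnion, iUnion_refinedAtom, Set.preimage_univ]
  · simp_rw [Set.inter_comm (refinedAtom T P m _)]
    rw [sum_measureReal_inter μ _ (hmeas m) (refinedAtom_disjoint T P m)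
      (iUnion_refinedAtom T P m) _ (hpre v)]
    exact (hT.iterate m).measureReal_preimage (hmeas n v).nullMeasurableSet
  · have := sum_measureReal_inter μ _ (hmeas m) (refinedAtom_disjoint T P m)
      (iUnion_refinedAtom T P m) univ MeasurableSet.univ
    simpa using this

/-- The limit defining `h_μ(T, 𝒫)` exists. -/
theorem tendsto_partitionEntropy {X : Type*} [MeasurableSpace X] {k : ℕ} (μ : Measure X)
    [IsProbabilityMeasure μ] {T : X → X} (hT : MeasurePreserving T μ μ)
    (P : FinMeasurablePartition X k) :
    Tendsto (fun n : ℕ => ((refinedEntropy μ T P n / n : ℝ) : EReal)) atTop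
      (𝓝 (partitionEntropy μ T P)) := by
  have hbdd : BddBelow (range fun n : ℕ => refinedEntropy μ T P n / n) := by
    refine ⟨0, ?_⟩
    rintro _ ⟨n, rfl⟩
    exact div_nonneg (Finset.sum_nonneg fun w _ =>
      Real.negMulLog_nonneg measureReal_nonneg measureReal_le_one) (Nat.cast_nonneg n)
  have h := (continuous_coe_real_ereal.tendsto _).comp
    ((refinedEntropy_subadditive μ hT P).tendsto_lim hbdd)
  have h' : Tendsto (fun n : ℕ => ((refinedEntropy μ T P n / n : ℝ) : EReal)) atTop _ := h
  rw [partitionEntropy, h'.limsup_eq]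
  exact h'

end

/-! Both inequalities are coding arguments that compare cylinders of a partition with dynamical
balls.

Entropy is at most the essential supremum. By Gibbs' inequality any subprobability weight `Q` on
words of length `N` gives `H(𝒫ᴺ) ≤ ∫ -log Q`, so it suffices to encode itineraries cheaply. If the
local entropy is below `c` almost everywhere, most points `x` have a length `n` in a fixed window
with `μ(B_n(x, r)) ≥ exp (-n c)`. About `exp (n c)` doubled balls cover all such points, and the
centre of a ball predicts the itinerary except at visits to a small set `E` where closeness does not
decide the atom. Parsing an orbit into such blocks, with single symbols where no block starts, costs
`c + o(1)` per symbol (`exists_block_weight`, `exists_word_weight`,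
`partitionEntropy_le_of_coding`). This direction needs only invariance of `μ`. The manifold enters
through σ-compactness: its compact sets exhaust almost every point.

The essential supremum is at most entropy. On a compact `K`, label points by a net of scale about `r
/ C ^ τ`, where `τ` is the return time to `K` and `C ≥ 1` a Lipschitz constant. Points whose labels
agree at all visits to `K` stay `r`-close in between, so cylinders lie in dynamical balls
(`mem_dynBall_of_close_at_visits`). Covering numbers of `K` are polynomial, hence a label costs
`O(τ)`, which is integrable by Kac's inequality. Long return times thus carry little information and
are split off from a finite partition (`exists_partition_small_conditional_info`), and
Borel–Cantelli bounds the joint cylinders from below (`ae_eventually_weight_le`). As the local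
entropy is a lower limit, good estimates along infinitely many `n` suffice; Fatou's lemma and
ergodicity provide them (`Ergodic.ae_frequently_le_mul`) without the Shannon–McMillan–Breiman
theorem. -/

noncomputable section

/-! ### Itineraries -/

namespace FinMeasurablePartition

variable {X : Type*} [MeasurableSpace X] {k : ℕ}

theorem exists_mem_atom (P : FinMeasurablePartition X k) (x : X) : ∃ j, x ∈ P.atom j := by
  have : x ∈ ⋃ j, P.atom j := by rw [P.iUnion_atom]; trivial
  exact Set.mem_iUnion.1 this

/-- The index of the atom containing `x`. -/
def label (P : FinMeasurablePartition X k) (x : X) : Fin k := (P.exists_mem_atom x).choose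

theorem mem_atom_label (P : FinMeasurablePartition X k) (x : X) : x ∈ P.atom (P.label x) :=
  (P.exists_mem_atom x).choose_spec

theorem mem_atom_iff (P : FinMeasurablePartition X k) {x : X} {j : Fin k} :
    x ∈ P.atom j ↔ P.label x = j := by
  constructor
  · intro h
    by_contra hne
    exact Set.disjoint_left.1 (P.disjoint_atom hne) (P.mem_atom_label x) h
  · rintro rfl
    exact P.mem_atom_label x

/-- The itinerary of length `n` of `x` with respect to the partition `P`. -/
def word (P : FinMeasurablePartition X k) (T : X → X) (n : ℕ) (x : X) : Fin n → Fin k :=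
  fun i => P.label (T^[(i : ℕ)] x)

theorem mem_refinedAtom_iff (P : FinMeasurablePartition X k) {T : X → X} {n : ℕ} {x : X}
    {w : Fin n → Fin k} : x ∈ refinedAtom T P n w ↔ P.word T n x = w := by
  simp only [refinedAtom, Set.mem_iInter, Set.mem_preimage, P.mem_atom_iff, funext_iff, word]

end FinMeasurablePartition

/-! ### Gibbs' inequality -/

theorem sum_negMulLog_le_sum_mul_neg_log {α : Type*} [Fintype α] {p q : α → ℝ}
    (hp : ∀ a, 0 ≤ p a) (hp1 : ∑ a, p a = 1) (hq : ∀ a, 0 < q a) (hq1 : ∑ a, q a ≤ 1) :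
    ∑ a, Real.negMulLog (p a) ≤ ∑ a, p a * -Real.log (q a) := by
  have key : ∀ a, Real.negMulLog (p a) ≤ p a * -Real.log (q a) + (q a - p a) := by
    intro a
    rcases (hp a).eq_or_lt with h | h
    · rw [← h]
      simpa using (hq a).le
    · have hl := Real.log_le_sub_one_of_pos (div_pos (hq a) h)
      rw [Real.log_div (hq a).ne' h.ne'] at hl
      have h2 := mul_le_mul_of_nonneg_left hl h.le
      have h3 : p a * (q a / p a - 1) = q a - p a := by field_simp
      rw [h3] at h2
      rw [Real.negMulLog]
      linarith
  calc ∑ a, Real.negMulLog (p a) ≤ ∑ a, (p a * -Real.log (q a) + (q a - p a)) :=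
        Finset.sum_le_sum fun a _ => key a
    _ = ∑ a, p a * -Real.log (q a) + (∑ a, q a - ∑ a, p a) := by
        rw [Finset.sum_add_distrib, Finset.sum_sub_distrib]
    _ ≤ _ := by rw [hp1]; linarith

/-- Expected code length bounds entropy. The majorant `f` is later a sum of Birkhoff sums, whose
integral is explicit by invariance. -/
theorem refinedEntropy_le_integral {X : Type*} [MeasurableSpace X] {k : ℕ} {μ : Measure X}
    [IsProbabilityMeasure μ] {T : X → X} (hT : Measurable T) (P : FinMeasurablePartition X k)
    {n : ℕ} {q : (Fin n → Fin k) → ℝ} (hq : ∀ w, 0 < q w) (hq1 : ∑ w, q w ≤ 1) {f : X → ℝ}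
    (hf : Integrable f μ) (hqf : ∀ x, -Real.log (q (P.word T n x)) ≤ f x) :
    refinedEntropy μ T P n ≤ ∫ x, f x ∂μ := by
  have hm := measurableSet_refinedAtom hT P n
  have hd := refinedAtom_disjoint T P n
  have hp1 : ∑ w, μ.real (refinedAtom T P n w) = 1 := by
    simpa using sum_measureReal_inter μ _ hm hd (iUnion_refinedAtom T P n) univ MeasurableSet.univ
  calc refinedEntropy μ T P n
      ≤ ∑ w, μ.real (refinedAtom T P n w) * -Real.log (q w) :=
        sum_negMulLog_le_sum_mul_neg_log (fun _ => measureReal_nonneg) hp1 hq hq1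
    _ = ∑ w, ∫ _ in refinedAtom T P n w, -Real.log (q w) ∂μ := by
        simp only [setIntegral_const, smul_eq_mul]
    _ ≤ ∑ w, ∫ x in refinedAtom T P n w, f x ∂μ := by
        refine Finset.sum_le_sum fun w _ => ?_
        refine setIntegral_mono_on (integrable_const _) hf.integrableOn (hm w) fun x hx => ?_
        rw [← P.mem_refinedAtom_iff.1 hx]
        exact hqf x
    _ = ∫ x, f x ∂μ := by
        rw [← integral_iUnion_fintype hm hd fun _ => hf.integrableOn, iUnion_refinedAtom,
          setIntegral_univ]

/-! ### Dynamical balls -/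

section DynBall

variable {X : Type*} [MetricSpace X]

theorem mem_dynBall_self (T : X → X) (n : ℕ) (x : X) {r : ℝ} (hr : 0 < r) :
    x ∈ dynBall T n x r := fun i _ => by simpa using hr

variable [MeasurableSpace X] [BorelSpace X] [SecondCountableTopology X]

theorem measurableSet_dynBall_prod {T : X → X} (hT : Measurable T) (n : ℕ) (r : ℝ) :
    MeasurableSet {p : X × X | p.2 ∈ dynBall T n p.1 r} := by
  have : {p : X × X | p.2 ∈ dynBall T n p.1 r} =
      ⋂ i ∈ Finset.range n, {p : X × X | dist (T^[i] p.1) (T^[i] p.2) < r} := by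
    ext p
    simp [dynBall]
  rw [this]
  refine Finset.measurableSet_biInter _ fun i _ => ?_
  exact measurableSet_lt (((hT.iterate i).comp measurable_fst).dist
    ((hT.iterate i).comp measurable_snd)) measurable_const

theorem measurableSet_dynBall {T : X → X} (hT : Measurable T) (n : ℕ) (x : X) (r : ℝ) :
    MeasurableSet (dynBall T n x r) :=
  measurable_prodMk_left (measurableSet_dynBall_prod hT n r)

theorem measurable_measure_dynBall {T : X → X} (hT : Measurable T) (μ : Measure X) [SFinite μ]
    (n : ℕ) (r : ℝ) : Measurable fun x => μ (dynBall T n x r) :=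
  measurable_measure_prodMk_left (measurableSet_dynBall_prod hT n r)

/-- Disjoint balls of mass at least `t` number at most `1 / t`, so a family of maximal cardinality
exists. By maximality any further ball of mass at least `t` meets a member, which doubles the
radius. -/
theorem exists_finset_dynBall_cover {T : X → X} (hT : Measurable T) (μ : Measure X)
    [IsProbabilityMeasure μ] (n : ℕ) {r t : ℝ} (hr : 0 < r) (ht : 0 < t) :
    ∃ F : Finset X, (F.card : ℝ) * t ≤ 1 ∧
      ∀ y, t ≤ μ.real (dynBall T n y r) → ∃ z ∈ F, y ∈ dynBall T n z (2 * r) := by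
  classical
  let p : ℕ → Prop := fun m => ∃ F : Finset X, F.card = m ∧
    (∀ z ∈ F, t ≤ μ.real (dynBall T n z r)) ∧
    (F : Set X).PairwiseDisjoint fun z => dynBall T n z r
  have hcard : ∀ F : Finset X, (∀ z ∈ F, t ≤ μ.real (dynBall T n z r)) →
      ((F : Set X).PairwiseDisjoint fun z => dynBall T n z r) → (F.card : ℝ) * t ≤ 1 := by
    intro F h1 h2
    calc (F.card : ℝ) * t = ∑ _z ∈ F, t := by simp
      _ ≤ ∑ z ∈ F, μ.real (dynBall T n z r) := Finset.sum_le_sum h1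
      _ = μ.real (⋃ z ∈ F, dynBall T n z r) :=
        (measureReal_biUnion_finset h2 fun z _ => measurableSet_dynBall hT n z r).symm
      _ ≤ 1 := measureReal_le_one
  have hbdd : ∀ m, p m → m ≤ ⌊1 / t⌋₊ := by
    rintro m ⟨F, rfl, h1, h2⟩
    exact Nat.le_floor ((le_div_iff₀ ht).2 (hcard F h1 h2))
  have hp0 : p 0 := ⟨∅, by simp, by simp, by simp⟩
  obtain ⟨F, hF, h1, h2⟩ : p (Nat.findGreatest p ⌊1 / t⌋₊) :=
    Nat.findGreatest_spec (Nat.zero_le _) hp0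
  refine ⟨F, hcard F h1 h2, fun y hy => ?_⟩
  by_contra! hcon
  have hdis : ∀ z ∈ F, Disjoint (dynBall T n y r) (dynBall T n z r) := by
    intro z hz
    refine Set.disjoint_left.2 fun u hu1 hu2 => hcon z hz fun i hi => ?_
    have a1 := hu1 i hi
    have a2 := hu2 i hi
    have := dist_triangle_right (T^[i] z) (T^[i] y) (T^[i] u)
    linarith
  have hyF : y ∉ F := fun h =>
    hcon y h (mem_dynBall_self T n y (by linarith))
  have hp : p (F.card + 1) := by
    refine ⟨insert y F, Finset.card_insert_of_notMem hyF, ?_, ?_⟩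
    · intro z hz
      rcases Finset.mem_insert.1 hz with rfl | hz
      exacts [hy, h1 z hz]
    · rw [Finset.coe_insert]
      exact h2.insert fun z hz _ => hdis z hz
  have := Nat.le_findGreatest (hbdd _ hp) hp
  omega

end DynBall

/-! ### Weights on words -/

theorem sum_word_mul {α : Type*} [Fintype α] {n m N : ℕ} (h : n + m = N)
    (R : (Fin n → α) → ℝ) (Q : (Fin m → α) → ℝ) :
    ∑ w : Fin N → α, R (fun i => w ⟨i, by omega⟩) * Q (fun i => w ⟨n + i, by omega⟩) =
      (∑ u, R u) * ∑ v, Q v := by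
  subst h
  rw [← (Fin.appendEquiv n m).sum_comp, Fintype.sum_prod_type, Finset.sum_mul_sum]
  refine Finset.sum_congr rfl fun u _ => Finset.sum_congr rfl fun v _ => ?_
  congr 2
  · ext i
    exact Fin.append_left u v i
  · ext i
    exact Fin.append_right u v i

theorem sum_prod_word {α : Type*} [Fintype α] {n : ℕ} (e : Fin n → α → ℝ) :
    ∑ w : Fin n → α, ∏ i, e i (w i) = ∏ i, ∑ a, e i a := by
  classical
  rw [Finset.prod_univ_sum]
  simp

/-! ### Block codes for itineraries -/

section Coding

variable {X : Type*} [MetricSpace X] [MeasurableSpace X] [BorelSpace X]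
  [SecondCountableTopology X] {k : ℕ}

/-- A weight on words of length `n` which charges the itineraries of all points whose dynamical
ball of length `n` has measure at least `exp (-n c)`. The set `E` consists of the points where
closeness does not determine the atom. -/
theorem exists_block_weight {T : X → X} (hT : Measurable T) (μ : Measure X)
    [IsProbabilityMeasure μ] (P : FinMeasurablePartition X k) {E : Set X} {r : ℝ} (hr : 0 < r)
    (hE : ∀ x ∉ E, ∀ y ∉ E, dist x y < 4 * r → P.label x = P.label y) {a b : ℝ}
    (hab : Real.exp (-a) + k * Real.exp (-b) ≤ 1) (c : ℝ) (n : ℕ) :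
    ∃ R : (Fin n → Fin k) → ℝ, (∀ w, 0 ≤ R w) ∧ ∑ w, R w ≤ Real.exp (n * c) ∧
      ∀ y, Real.exp (-(n * c)) ≤ μ.real (dynBall T n y r) →
        Real.exp (-(n * a + b * birkhoffSum T (E.indicator 1) n y)) ≤ R (P.word T n y) := by
  classical
  obtain ⟨F, hF, hcov⟩ := exists_finset_dynBall_cover hT μ n hr (Real.exp_pos (-(n * c)))
  -- The word predicted by the centre `z`. Two points of the ball are `4 * r`-close at each time, so
  -- those outside `E` share a label; `none` marks times at which every point of the ball is in `E`.
  have href : ∀ z : X, ∃ v : Fin n → Option (Fin k), ∀ y ∈ dynBall T n z (2 * r), ∀ i : Fin n,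
      T^[(i : ℕ)] y ∉ E → v i = some (P.label (T^[(i : ℕ)] y)) := by
    intro z
    have : ∀ i : Fin n, ∃ j : Option (Fin k), ∀ y ∈ dynBall T n z (2 * r),
        T^[(i : ℕ)] y ∉ E → j = some (P.label (T^[(i : ℕ)] y)) := by
      intro i
      by_cases h : ∃ y ∈ dynBall T n z (2 * r), T^[(i : ℕ)] y ∉ E
      · obtain ⟨y, hy, hyE⟩ := h
        refine ⟨some (P.label (T^[(i : ℕ)] y)), fun y' hy' hyE' => congrArg some ?_⟩
        refine hE _ hyE _ hyE' ?_
        have h1 := hy i i.2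
        have h2 := hy' i i.2
        have := dist_triangle_left (T^[(i : ℕ)] y) (T^[(i : ℕ)] y') (T^[(i : ℕ)] z)
        linarith
      · push Not at h
        exact ⟨none, fun y hy hyE => absurd (h y hy) hyE⟩
    choose v hv using this
    exact ⟨v, fun y hy i => hv i y hy⟩
  choose v hv using href
  -- A correctly predicted symbol costs at most `a`, any other symbol `b`; `hab` makes this a
  -- subprobability on symbols.
  let e : X → Fin n → Fin k → ℝ := fun z i j =>
    (if v z i = some j then Real.exp (-a) else 0) + Real.exp (-b)
  have he0 : ∀ z i j, 0 ≤ e z i j := by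
    intro z i j
    have := (Real.exp_pos (-a)).le
    have := (Real.exp_pos (-b)).le
    simp only [e]
    split_ifs <;> linarith
  have he1 : ∀ z i, ∑ j, e z i j ≤ 1 := by
    intro z i
    have h1 : ∑ j, (if v z i = some j then Real.exp (-a) else 0) ≤ Real.exp (-a) := by
      cases v z i with
      | none => simpa using (Real.exp_pos (-a)).le
      | some j0 => simp
    simp only [e, Finset.sum_add_distrib, Finset.sum_const, Finset.card_univ, Fintype.card_fin,
      nsmul_eq_mul]
    linarith
  refine ⟨fun w => ∑ z ∈ F, ∏ i, e z i (w i),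
    fun w => Finset.sum_nonneg fun z _ => Finset.prod_nonneg fun i _ => he0 z i _, ?_, ?_⟩
  · rw [Finset.sum_comm]
    calc ∑ z ∈ F, ∑ w : Fin n → Fin k, ∏ i, e z i (w i)
        = ∑ z ∈ F, ∏ i, ∑ j, e z i j := Finset.sum_congr rfl fun z _ => sum_prod_word (e z)
      _ ≤ ∑ z ∈ F, 1 := Finset.sum_le_sum fun z _ =>
          Finset.prod_le_one (fun i _ => Finset.sum_nonneg fun j _ => he0 z i j)
            fun i _ => he1 z i
      _ = (F.card : ℝ) := by simp
      _ ≤ Real.exp (n * c) := by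
          rw [Real.exp_neg, ← div_eq_mul_inv, div_le_one (Real.exp_pos _)] at hF
          exact hF
  · intro y hy
    obtain ⟨z, hz, hyz⟩ := hcov y hy
    refine le_trans ?_ (Finset.single_le_sum (f := fun z => ∏ i, e z i (P.word T n y i))
      (fun z _ => Finset.prod_nonneg fun i _ => he0 z i _) hz)
    have hsum : -(n * a + b * birkhoffSum T (E.indicator 1) n y) =
        ∑ i : Fin n, -(a + b * E.indicator (1 : X → ℝ) (T^[(i : ℕ)] y)) := by
      rw [Fin.sum_univ_eq_sum_range (fun i => -(a + b * E.indicator (1 : X → ℝ) (T^[i] y))),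
        Finset.sum_neg_distrib, Finset.sum_add_distrib, ← Finset.mul_sum, birkhoffSum]
      simp
    rw [hsum, Real.exp_sum]
    refine Finset.prod_le_prod (fun i _ => (Real.exp_pos _).le) fun i _ => ?_
    have ha : 0 ≤ a := by
      have : Real.exp (-a) ≤ 1 := by
        have := (Real.exp_pos (-b)).le
        have : 0 ≤ k * Real.exp (-b) := by positivity
        linarith
      linarith [Real.exp_le_one_iff.1 this]
    by_cases hi : T^[(i : ℕ)] y ∈ E
    · rw [indicator_of_mem hi]
      have h1 : Real.exp (-(a + b * (1 : X → ℝ) (T^[(i : ℕ)] y))) ≤ Real.exp (-b) := by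
        refine Real.exp_le_exp.2 ?_
        simp only [Pi.one_apply]
        linarith
      refine h1.trans ?_
      have := (Real.exp_pos (-a)).le
      simp only [e]
      split_ifs <;> linarith
    · rw [indicator_of_notMem hi]
      have : v z i = some (P.word T n y i) := hv z y hyz i hi
      simp only [e, this, if_true, mul_zero, add_zero]
      linarith [Real.exp_pos (-b)]

/-- A subprobability weight on words of length `N`, obtained by parsing itineraries into blocks
along which dynamical balls are large, and single symbols. -/
theorem exists_word_weight {T : X → X} (hT : Measurable T) (μ : Measure X)
    [IsProbabilityMeasure μ] (P : FinMeasurablePartition X k) {E D : Set X} {r : ℝ} (hr : 0 < r)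
    (hE : ∀ x ∉ E, ∀ y ∉ E, dist x y < 4 * r → P.label x = P.label y) {a b c η B : ℝ}
    (hab : Real.exp (-a) + k * Real.exp (-b) ≤ 1) (ha : 0 ≤ a) (hb : 0 ≤ b) (hc : 0 ≤ c)
    (hη : 0 ≤ η) (hB : 0 ≤ B) (hkB : k * Real.exp (-B) ≤ 1 / 2) {l l' : ℕ} (hl : 1 ≤ l)
    (hll : ∑ n ∈ Finset.Icc l l', Real.exp (-(n * η)) ≤ 1 / 2)
    (hD : ∀ x ∈ D, ∃ n ∈ Finset.Icc l l', Real.exp (-(n * c)) ≤ μ.real (dynBall T n x r))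
    (N : ℕ) :
    ∃ Q : (Fin N → Fin k) → ℝ, (∀ w, Real.exp (-(N * B)) ≤ Q w) ∧ ∑ w, Q w ≤ 1 ∧
      ∀ x, Real.exp (-(N * (c + η + a) + b * birkhoffSum T (E.indicator 1) N x +
        B * birkhoffSum T (Dᶜ.indicator 1) N x + B * l')) ≤ Q (P.word T N x) := by
  classical
  have hS0 : ∀ (S : Set X) n x, 0 ≤ birkhoffSum T (S.indicator (1 : X → ℝ)) n x :=
    fun S n x => Finset.sum_nonneg fun i _ => indicator_nonneg (fun _ _ => zero_le_one) _
  choose R hR0 hRsum hR using fun n => exists_block_weight hT μ P hr hE hab c n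
  induction N using Nat.strong_induction_on with
  | _ N ih =>
  rcases N.eq_zero_or_pos with rfl | hN
  · refine ⟨fun _ => 1, by simp, by simp, fun x => ?_⟩
    simp only [birkhoffSum_zero', Nat.cast_zero, zero_mul, mul_zero, Pi.zero_apply, zero_add]
    exact Real.exp_le_one_iff.2 (by have := mul_nonneg hB (Nat.cast_nonneg (α := ℝ) l'); linarith)
  choose Q hQB hQ1 hQ using ih
  have hQ0 : ∀ m (hm : m < N) w, 0 ≤ Q m hm w := fun m hm w => (Real.exp_pos _).le.trans (hQB m hm w)
  -- A block of length `n` followed by a code for the rest. The factor `exp (-n c)` cancels the mass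
  -- of `R n`; `exp (-n η)` pays for announcing the length and is summable to `1 / 2` over the
  -- window.
  let blk : ℕ → (Fin N → Fin k) → ℝ := fun n w =>
    if h : 1 ≤ n ∧ n ≤ N then Real.exp (-(n * (c + η))) *
      (R n (fun i => w ⟨i, by omega⟩) * Q (N - n) (by omega) (fun i => w ⟨n + i, by omega⟩))
    else 0
  have hblk0 : ∀ n w, 0 ≤ blk n w := by
    intro n w
    simp only [blk]
    split_ifs with h
    · exact mul_nonneg (Real.exp_pos _).le (mul_nonneg (hR0 _ _) (hQ0 _ _ _))
    · exact le_rfl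
  -- The other half of the mass: spell out one symbol at price `B`, used at points outside `D`.
  let sgl : (Fin N → Fin k) → ℝ := fun w =>
    Real.exp (-B) * Q (N - 1) (by omega) (fun i => w ⟨1 + i, by omega⟩)
  have hsgl0 : ∀ w, 0 ≤ sgl w := fun w => mul_nonneg (Real.exp_pos _).le (hQ0 _ _ _)
  have hsum0 : ∀ w, 0 ≤ ∑ n ∈ Finset.Icc l l', blk n w :=
    fun w => Finset.sum_nonneg fun n _ => hblk0 n w
  have hNcast : (((N - 1 : ℕ) : ℝ)) = N - 1 := by
    rw [Nat.cast_sub hN, Nat.cast_one]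
  have hlow : ∀ w, Real.exp (-(N * B)) ≤ sgl w + ∑ n ∈ Finset.Icc l l', blk n w := by
    intro w
    have h1 : Real.exp (-(N * B)) ≤ sgl w := by
      have : Real.exp (-(N * B)) = Real.exp (-B) * Real.exp (-((N - 1 : ℕ) * B)) := by
        rw [← Real.exp_add, hNcast]
        congr 1
        ring
      rw [this]
      exact mul_le_mul_of_nonneg_left (hQB _ _ _) (Real.exp_pos _).le
    linarith [hsum0 w]
  refine ⟨fun w => sgl w + ∑ n ∈ Finset.Icc l l', blk n w, hlow, ?_, fun x => ?_⟩
  · rw [Finset.sum_add_distrib, Finset.sum_comm]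
    have h1 : ∑ w, sgl w ≤ 1 / 2 := by
      have h := sum_word_mul (α := Fin k) (n := 1) (m := N - 1) (N := N) (by omega)
        (fun _ => Real.exp (-B)) (Q (N - 1) (by omega))
      simp only [sgl]
      rw [h]
      simp only [Finset.sum_const, Finset.card_univ, Fintype.card_fun, Fintype.card_fin, pow_one,
        nsmul_eq_mul]
      have h2 := hQ1 (N - 1) (by omega)
      have h3 : 0 ≤ k * Real.exp (-B) := by positivity
      nlinarith [mul_le_mul_of_nonneg_left h2 h3]
    have h2 : ∀ n ∈ Finset.Icc l l', ∑ w, blk n w ≤ Real.exp (-(n * η)) := by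
      intro n _
      by_cases h : 1 ≤ n ∧ n ≤ N
      · simp only [blk, dif_pos h]
        rw [← Finset.mul_sum, sum_word_mul (α := Fin k) (n := n) (m := N - n) (N := N) (by omega)
          (R n) (Q (N - n) (by omega))]
        have h3 := hQ1 (N - n) (by omega)
        have h4 : (∑ u, R n u) * ∑ v, Q (N - n) (by omega) v ≤ Real.exp (n * c) * 1 :=
          mul_le_mul (hRsum n) h3 (Finset.sum_nonneg fun v _ => hQ0 _ _ v) (Real.exp_pos _).le
        have h5 : Real.exp (-(n * η)) = Real.exp (-(n * (c + η))) * (Real.exp (n * c) * 1) := by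
          rw [mul_one, ← Real.exp_add]
          congr 1
          ring
        rw [h5]
        exact mul_le_mul_of_nonneg_left h4 (Real.exp_pos _).le
      · simp only [blk, dif_neg h, Finset.sum_const_zero]
        exact (Real.exp_pos _).le
    have := Finset.sum_le_sum h2
    linarith
  · have hshift : ∀ (S : Set X) n, n ≤ N → birkhoffSum T (S.indicator (1 : X → ℝ)) N x =
        birkhoffSum T (S.indicator 1) n x +
          birkhoffSum T (S.indicator 1) (N - n) (T^[n] x) := by
      intro S n hn
      rw [← birkhoffSum_add, Nat.add_sub_cancel' hn]
    have hword : ∀ n (hn : n ≤ N), (fun i : Fin (N - n) => P.word T N x ⟨n + i, by omega⟩) =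
        P.word T (N - n) (T^[n] x) := by
      intro n hn
      ext1 i
      simp only [FinMeasurablePartition.word]
      rw [← Function.iterate_add_apply, add_comm]
    by_cases hx : x ∈ D
    · obtain ⟨n, hn, hnx⟩ := hD x hx
      have hn1 : 1 ≤ n := hl.trans (Finset.mem_Icc.1 hn).1
      by_cases hnN : n ≤ N
      · refine le_trans ?_ (le_add_of_nonneg_left (hsgl0 _))
        refine le_trans ?_ (Finset.single_le_sum (f := fun n => blk n (P.word T N x))
          (fun n _ => hblk0 n _) hn)
        simp only [blk, dif_pos (And.intro hn1 hnN)]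
        rw [hword n hnN]
        have h1 := hR n x hnx
        have h2 := hQ (N - n) (by omega) (T^[n] x)
        refine le_trans ?_ (mul_le_mul_of_nonneg_left (mul_le_mul h1 h2 (Real.exp_pos _).le
          (hR0 _ _)) (Real.exp_pos _).le)
        rw [← Real.exp_add, ← Real.exp_add]
        refine Real.exp_le_exp.2 ?_
        rw [hshift E n hnN, hshift Dᶜ n hnN, Nat.cast_sub hnN]
        have h3 := mul_nonneg hB (hS0 Dᶜ n x)
        linarith
      -- The block would overrun the word, so `N < n ≤ l'` and spelling everything out costs at most
      -- `B * l'`. This is the origin of the additive term in the exponent.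
      · refine le_trans (Real.exp_le_exp.2 ?_) (hlow _)
        have h1 := mul_nonneg hb (hS0 E N x)
        have h2 := mul_nonneg hB (hS0 Dᶜ N x)
        have h3 : (N : ℝ) * B ≤ B * l' := by
          rw [mul_comm]
          refine mul_le_mul_of_nonneg_left ?_ hB
          have := (Finset.mem_Icc.1 hn).2
          exact_mod_cast (by omega : N ≤ l')
        have h4 : 0 ≤ (N : ℝ) * (c + η + a) := by positivity
        linarith
    · refine le_trans ?_ (le_add_of_nonneg_right (hsum0 _))
      simp only [sgl]
      rw [hword 1 hN]
      refine le_trans ?_ (mul_le_mul_of_nonneg_left (hQ (N - 1) (by omega) (T^[1] x))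
        (Real.exp_pos _).le)
      rw [← Real.exp_add]
      refine Real.exp_le_exp.2 ?_
      rw [hshift E 1 hN, hshift Dᶜ 1 hN, hNcast, birkhoffSum_one', birkhoffSum_one',
        indicator_of_mem (show x ∈ Dᶜ from hx), Pi.one_apply]
      have h1 : 0 ≤ b * E.indicator (1 : X → ℝ) x :=
        mul_nonneg hb (indicator_nonneg (fun _ _ => zero_le_one) _)
      nlinarith

end Coding

/-! ### Integrals of Birkhoff sums -/

section BirkhoffIntegral

variable {X : Type*} [MeasurableSpace X] {μ : Measure X} {T : X → X}

theorem integrable_birkhoffSum {f : X → ℝ} (hT : MeasurePreserving T μ μ) (hf : Integrable f μ)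
    (n : ℕ) : Integrable (birkhoffSum T f n) μ := by
  have : birkhoffSum T f n = fun x => ∑ i ∈ Finset.range n, f (T^[i] x) := rfl
  rw [this]
  exact integrable_finsetSum _ fun i _ => (hT.iterate i).integrable_comp_of_integrable hf

theorem integral_birkhoffSum_indicator [IsFiniteMeasure μ] (hT : MeasurePreserving T μ μ)
    {S : Set X} (hS : MeasurableSet S) (n : ℕ) :
    ∫ x, birkhoffSum T (S.indicator (1 : X → ℝ)) n x ∂μ = n * μ.real S := by
  have hi : Integrable (S.indicator (1 : X → ℝ)) μ := (integrable_const 1).indicator hS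
  simp only [birkhoffSum]
  rw [integral_finsetSum (f := fun i x => S.indicator (1 : X → ℝ) (T^[i] x)) _
    fun i _ => (hT.iterate i).integrable_comp_of_integrable hi]
  have : ∀ i, ∫ x, S.indicator (1 : X → ℝ) (T^[i] x) ∂μ = μ.real S := by
    intro i
    have h : (fun x => S.indicator (1 : X → ℝ) (T^[i] x)) = (T^[i] ⁻¹' S).indicator 1 := by
      ext x
      rfl
    rw [h, integral_indicator_one ((hT.measurable.iterate i) hS),
      (hT.iterate i).measureReal_preimage hS.nullMeasurableSet]
  simp [this]

end BirkhoffIntegral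

/-! ### Entropy is at most the essential supremum of local entropy -/

section LowerBound

variable {X : Type*} [MetricSpace X] [MeasurableSpace X]

theorem ballDecay_le_lowerLocalEntropy (μ : Measure X) (T : X → X) (x : X) {r : ℝ} (hr : 0 < r) :
    ballDecay μ T x r ≤ lowerLocalEntropy μ T x := by
  refine ge_of_tendsto (tendsto_lowerLocalEntropy μ T x) ?_
  filter_upwards [Ioo_mem_nhdsGT hr] with s hs
  exact ballDecay_antitone μ T x hs.2.le

theorem frequently_exp_le_dynBall (μ : Measure X) [IsFiniteMeasure μ] {T : X → X} {x : X} {r c : ℝ}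
    (h : ballDecay μ T x r < c) :
    ∃ᶠ n : ℕ in atTop, Real.exp (-(n * c)) ≤ μ.real (dynBall T n x r) := by
  refine ((frequently_lt_of_liminf_lt (by isBoundedDefault) h).and_eventually
    (eventually_ge_atTop 1)).mono ?_
  rintro n ⟨hn, hn1⟩
  by_contra! hlt
  have hn0 : (0 : EReal) < (n : EReal) := by exact_mod_cast hn1
  have h1 : μ (dynBall T n x r) ≤ ENNReal.ofReal (Real.exp (-(n * c))) := by
    rw [← ofReal_measureReal]
    exact ENNReal.ofReal_le_ofReal hlt.le
  have h2 := ENNReal.log_monotone h1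
  rw [ENNReal.log_ofReal_of_pos (Real.exp_pos _), Real.log_exp] at h2
  have h3 : ENNReal.log (μ (dynBall T n x r)) / (n : EReal) ≤ ((-c : ℝ) : EReal) := by
    rw [EReal.div_le_iff_le_mul hn0 (EReal.natCast_ne_top n)]
    refine h2.trans (le_of_eq ?_)
    norm_cast
    ring_nf
  have h4 := EReal.neg_le_neg_iff.2 h3
  rw [← EReal.coe_neg, neg_neg] at h4
  exact absurd hn (not_lt.2 h4)

variable [BorelSpace X]

/-- Integrating the code length of `exists_word_weight` turns visits to `E` and `Dᶜ` into their
measures, and division by `N` removes the boundary term `B * l'`. -/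
theorem partitionEntropy_le_of_coding [SecondCountableTopology X] {k : ℕ} {T : X → X}
    {μ : Measure X} [IsProbabilityMeasure μ]
    (hT : MeasurePreserving T μ μ) (P : FinMeasurablePartition X k) {E D : Set X}
    (hEm : MeasurableSet E) (hDm : MeasurableSet D) {r : ℝ} (hr : 0 < r)
    (hE : ∀ x ∉ E, ∀ y ∉ E, dist x y < 4 * r → P.label x = P.label y) {a b c η B : ℝ}
    (hab : Real.exp (-a) + k * Real.exp (-b) ≤ 1) (ha : 0 ≤ a) (hb : 0 ≤ b) (hc : 0 ≤ c)
    (hη : 0 ≤ η) (hB : 0 ≤ B) (hkB : k * Real.exp (-B) ≤ 1 / 2) {l l' : ℕ} (hl : 1 ≤ l)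
    (hll : ∑ n ∈ Finset.Icc l l', Real.exp (-(n * η)) ≤ 1 / 2)
    (hD : ∀ x ∈ D, ∃ n ∈ Finset.Icc l l', Real.exp (-(n * c)) ≤ μ.real (dynBall T n x r)) :
    partitionEntropy μ T P ≤
      ((c + η + a + b * μ.real E + B * μ.real Dᶜ : ℝ) : EReal) := by
  have hbound : ∀ N : ℕ, 1 ≤ N → refinedEntropy μ T P N / N ≤
      c + η + a + b * μ.real E + B * μ.real Dᶜ + B * l' / N := by
    intro N hN
    obtain ⟨Q, hQB, hQ1, hQ⟩ := exists_word_weight hT.measurable μ P hr hE hab ha hb hc hη hB hkB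
      hl hll hD N
    have hQ0 : ∀ w, 0 < Q w := fun w => (Real.exp_pos _).trans_le (hQB w)
    have hiE : Integrable (fun x => b * birkhoffSum T (E.indicator (1 : X → ℝ)) N x) μ :=
      (integrable_birkhoffSum hT ((integrable_const (1 : ℝ)).indicator hEm) N).const_mul b
    have hiD : Integrable (fun x => B * birkhoffSum T (Dᶜ.indicator (1 : X → ℝ)) N x) μ :=
      (integrable_birkhoffSum hT ((integrable_const (1 : ℝ)).indicator hDm.compl) N).const_mul B
    have hi1 : Integrable (fun x => N * (c + η + a) +
        b * birkhoffSum T (E.indicator (1 : X → ℝ)) N x) μ := (integrable_const _).add hiE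
    have hi2 : Integrable (fun x => N * (c + η + a) +
        b * birkhoffSum T (E.indicator (1 : X → ℝ)) N x +
        B * birkhoffSum T (Dᶜ.indicator (1 : X → ℝ)) N x) μ := hi1.add hiD
    have h := refinedEntropy_le_integral hT.measurable P (n := N) hQ0 hQ1
      (hi2.add (integrable_const (B * (l' : ℝ)))) fun x => by
        have := Real.log_le_log (Real.exp_pos _) (hQ x)
        rw [Real.log_exp] at this
        simp only [Pi.add_apply]
        linarith
    simp only [Pi.add_apply] at h
    rw [integral_add hi2 (integrable_const _), integral_add hi1 hiD,
      integral_add (integrable_const _) hiE,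
      integral_const_mul b, integral_const_mul B, integral_birkhoffSum_indicator hT hEm,
      integral_birkhoffSum_indicator hT hDm.compl] at h
    simp only [integral_const, probReal_univ, one_smul] at h
    have hN' : (0 : ℝ) < N := by exact_mod_cast hN
    rw [div_le_iff₀ hN']
    refine h.trans (le_of_eq ?_)
    field_simp
  refine le_of_tendsto_of_tendsto (tendsto_partitionEntropy μ hT P)
    (g := fun N : ℕ => ((c + η + a + b * μ.real E + B * μ.real Dᶜ + B * l' / N : ℝ) : EReal))
    ?_ ?_
  · refine (continuous_coe_real_ereal.tendsto _).comp ?_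
    simpa using (tendsto_const_div_atTop_nhds_zero_nat (B * (l' : ℝ))).const_add
      (c + η + a + b * μ.real E + B * μ.real Dᶜ)
  · filter_upwards [eventually_ge_atTop 1] with N hN
    exact EReal.coe_le_coe_iff.2 (hbound N hN)

/-- Outside a set of small measure, nearby points lie in the same atom. -/
theorem exists_separating_scale [SecondCountableTopology X] [CompleteSpace X] {k : ℕ}
    (μ : Measure X) [IsFiniteMeasure μ] (P : FinMeasurablePartition X k) {ε : ℝ} (hε : 0 < ε) :
    ∃ E : Set X, MeasurableSet E ∧ μ.real E ≤ ε ∧ ∃ r > 0, ∀ x ∉ E, ∀ y ∉ E,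
      dist x y < 4 * r → P.label x = P.label y := by
  have hδ : ENNReal.ofReal (ε / (k + 1)) ≠ 0 := by
    rw [Ne, ENNReal.ofReal_eq_zero, not_le]
    positivity
  -- Compact subsets of the atoms are pairwise at positive distance; `E` will be what they miss. The
  -- `+ 1` in `ε / (k + 1)` covers `k = 0`.
  choose K hKs hKc hKm using fun j =>
    (P.measurableSet_atom j).exists_isCompact_sdiff_lt (measure_ne_top μ _) hδ
  have hpair : ∀ i j, ∀ᶠ r : ℝ in 𝓝[>] 0, i ≠ j → ∀ x ∈ K i, ∀ y ∈ K j, 4 * r ≤ dist x y := by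
    intro i j
    by_cases hij : i = j
    · exact Eventually.of_forall fun r h => absurd hij h
    have hdis : Disjoint (K i) (K j) := (P.disjoint_atom hij).mono (hKs i) (hKs j)
    obtain ⟨δ, hδ0, hδ⟩ := hdis.exists_thickenings (hKc i) (hKc j).isClosed
    filter_upwards [Ioo_mem_nhdsGT (show (0 : ℝ) < δ / 4 by positivity)] with r hr _ x hx y hy
    by_contra! hlt
    have h1 : y ∈ Metric.thickening δ (K i) :=
      Metric.mem_thickening_iff.2 ⟨x, hx, by rw [dist_comm]; linarith [hr.2]⟩
    have h2 : y ∈ Metric.thickening δ (K j) := Metric.self_subset_thickening hδ0 _ hy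
    exact Set.disjoint_left.1 hδ h1 h2
  obtain ⟨r, hr, hr0⟩ := ((eventually_all.2 fun i => eventually_all.2 fun j => hpair i j).and
    self_mem_nhdsWithin).exists
  refine ⟨(⋃ j, K j)ᶜ, (MeasurableSet.iUnion fun j => (hKc j).measurableSet).compl, ?_, r, hr0,
    ?_⟩
  · have hsub : (⋃ j, K j)ᶜ ⊆ ⋃ j, P.atom j \ K j := by
      intro x hx
      refine Set.mem_iUnion.2 ⟨P.label x, P.mem_atom_label x, fun h => hx ?_⟩
      exact Set.mem_iUnion.2 ⟨_, h⟩
    calc μ.real (⋃ j, K j)ᶜ ≤ μ.real (⋃ j, P.atom j \ K j) := measureReal_mono hsub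
      _ ≤ ∑ j, μ.real (P.atom j \ K j) := measureReal_iUnion_fintype_le _
      _ ≤ ∑ _j : Fin k, ε / (k + 1) := by
          refine Finset.sum_le_sum fun j _ => ?_
          exact ENNReal.toReal_le_of_le_ofReal (by positivity) (hKm j).le
      _ ≤ ε := by
          simp only [Finset.sum_const, Finset.card_univ, Fintype.card_fin, nsmul_eq_mul]
          rw [mul_div_assoc', div_le_iff₀ (by positivity)]
          nlinarith
  · intro x hx y hy hxy
    obtain ⟨i, hi⟩ := Set.mem_iUnion.1 (not_not.1 hx)
    obtain ⟨j, hj⟩ := Set.mem_iUnion.1 (not_not.1 hy)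
    rw [P.mem_atom_iff.1 (hKs i hi), P.mem_atom_iff.1 (hKs j hj)]
    by_contra hij
    exact absurd hxy (not_lt.2 (hr i j hij x hi y hj))

/-- A lower limit below `c` gives good lengths beyond any `l` at almost every point, so the sets of
points with a good length in `[l, l']` increase to full measure as `l'` grows. -/
theorem exists_large_dynBall_set [SecondCountableTopology X] {T : X → X} (hT : Measurable T)
    (μ : Measure X) [IsProbabilityMeasure μ] {r c : ℝ} (hc : ∀ᵐ x ∂μ, ballDecay μ T x r < c)
    (l : ℕ) {ε : ℝ} (hε : 0 < ε) :
    ∃ (l' : ℕ) (D : Set X), MeasurableSet D ∧ μ.real Dᶜ ≤ ε ∧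
      ∀ x ∈ D, ∃ n ∈ Finset.Icc l l', Real.exp (-(n * c)) ≤ μ.real (dynBall T n x r) := by
  let D : ℕ → Set X := fun l' =>
    ⋃ n ∈ Finset.Icc l l', {x | Real.exp (-(n * c)) ≤ μ.real (dynBall T n x r)}
  have hDm : ∀ l', MeasurableSet (D l') := fun l' =>
    Finset.measurableSet_biUnion _ fun n _ =>
      measurableSet_le measurable_const (measurable_measure_dynBall hT μ n r).ennreal_toReal
  have hmono : Monotone D := by
    intro i j hij
    refine Set.biUnion_subset_biUnion_left fun n hn => ?_
    have := Finset.mem_Icc.1 hn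
    exact Finset.mem_Icc.2 ⟨this.1, this.2.trans hij⟩
  have hanti : Antitone fun l' => (D l')ᶜ := fun i j hij => compl_subset_compl.2 (hmono hij)
  have hzero : μ (⋂ l', (D l')ᶜ) = 0 := by
    rw [← Set.compl_iUnion]
    refine measure_mono_null (fun x hx => ?_) (ae_iff.1 hc)
    intro hlt
    obtain ⟨n, hn, hnx⟩ := (frequently_atTop.1 (frequently_exp_le_dynBall μ hlt)) l
    refine hx (Set.mem_iUnion.2 ⟨n, Set.mem_iUnion₂.2 ⟨n, ?_, hnx⟩⟩)
    exact Finset.mem_Icc.2 ⟨hn, le_rfl⟩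
  have hlim := tendsto_measure_iInter_atTop (μ := μ)
    (fun l' => (hDm l').compl.nullMeasurableSet) hanti ⟨0, measure_ne_top _ _⟩
  rw [hzero] at hlim
  obtain ⟨l', hl'⟩ := (hlim.eventually (gt_mem_nhds (ENNReal.ofReal_pos.2 hε))).exists
  refine ⟨l', D l', hDm l', ENNReal.toReal_le_of_le_ofReal hε.le hl'.le, fun x hx => ?_⟩
  obtain ⟨n, hn, hnx⟩ := Set.mem_iUnion₂.1 hx
  exact ⟨n, hn, hnx⟩

/-- One `l` must serve every `l'`, because `l'` is obtained only after `l` is fixed. -/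
theorem exists_tail_exp_sum_le {η : ℝ} (hη : 0 < η) :
    ∃ l : ℕ, 1 ≤ l ∧ ∀ l', ∑ n ∈ Finset.Icc l l', Real.exp (-(n * η)) ≤ 1 / 2 := by
  have hs : Summable fun n : ℕ => Real.exp (-(n * η)) := by
    have := Real.summable_exp_nat_mul_iff.2 (neg_lt_zero.2 hη)
    simpa [mul_neg] using this
  obtain ⟨s, hs'⟩ := summable_iff_vanishing_norm.1 hs (1 / 2) (by norm_num)
  refine ⟨s.sup id + 1, by omega, fun l' => ?_⟩
  refine (le_abs_self _).trans (hs' _ ?_).le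
  rw [Finset.disjoint_left]
  intro n hn hns
  have := Finset.le_sup (f := id) hns
  have := (Finset.mem_Icc.1 hn).1
  simp only [id] at *
  omega

/-- The measure-theoretic entropy is at most any a.e. upper bound for the lower local entropy. -/
theorem measureEntropy_le_of_ae_lowerLocalEntropy_le [SecondCountableTopology X]
    [CompleteSpace X] {T : X → X} {μ : Measure X} [IsProbabilityMeasure μ]
    (hT : MeasurePreserving T μ μ) {c : EReal}
    (hc : ∀ᵐ x ∂μ, lowerLocalEntropy μ T x ≤ c) : measureEntropy μ T ≤ c := by
  refine iSup₂_le fun k P => ?_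
  refine EReal.le_of_forall_lt_iff_le.1 fun z hz => ?_
  have hz' : ∀ r > 0, ∀ᵐ x ∂μ, ballDecay μ T x r < z := fun r hr =>
    hc.mono fun x hx => ((ballDecay_le_lowerLocalEntropy μ T x hr).trans hx).trans_lt hz
  have hz0 : 0 ≤ z := by
    obtain ⟨x, hx⟩ := (hz' 1 one_pos).exists
    obtain ⟨n, hn, hnx⟩ := (frequently_atTop.1 (frequently_exp_le_dynBall μ hx)) 1
    have h1 := Real.exp_le_one_iff.1 (hnx.trans measureReal_le_one)
    have h2 : (0 : ℝ) < n := by exact_mod_cast hn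
    by_contra! hneg
    nlinarith
  refine EReal.le_of_forall_lt_iff_le.1 fun y hy => ?_
  -- One `ε` each for `η`, `a`, `b * μ.real E` and `B * μ.real Dᶜ`.
  obtain ⟨ε, hε, rfl⟩ : ∃ ε : ℝ, 0 < ε ∧ y = z + 4 * ε :=
    ⟨(y - z) / 4, by linarith [EReal.coe_lt_coe_iff.1 hy], by ring⟩
  obtain ⟨b, hb, hab⟩ : ∃ b : ℝ, 0 < b ∧ Real.exp (-ε) + k * Real.exp (-b) ≤ 1 := by
    have h0 : 0 < 1 - Real.exp (-ε) := by
      linarith [Real.exp_lt_one_iff.2 (neg_lt_zero.2 hε)]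
    have hlim : Tendsto (fun b : ℝ => k * Real.exp (-b)) atTop (𝓝 0) := by
      simpa using (Real.tendsto_exp_neg_atTop_nhds_zero).const_mul (k : ℝ)
    obtain ⟨b, hb1, hb2⟩ := ((eventually_gt_atTop 0).and
      (hlim.eventually (gt_mem_nhds h0))).exists
    exact ⟨b, hb1, by linarith⟩
  obtain ⟨B, hB, hkB⟩ : ∃ B : ℝ, 0 < B ∧ k * Real.exp (-B) ≤ 1 / 2 := by
    have hlim : Tendsto (fun b : ℝ => k * Real.exp (-b)) atTop (𝓝 0) := by
      simpa using (Real.tendsto_exp_neg_atTop_nhds_zero).const_mul (k : ℝ)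
    obtain ⟨b, hb1, hb2⟩ := ((eventually_gt_atTop 0).and
      (hlim.eventually (gt_mem_nhds (show (0 : ℝ) < 1 / 2 by norm_num)))).exists
    exact ⟨b, hb1, hb2.le⟩
  -- The prices `b` and `B` depend only on `k` and `ε`, so the exceptional sets may be taken small
  -- relative to them; `D` comes last since it depends on the scale `r`.
  obtain ⟨E, hEm, hEμ, r, hr, hE⟩ := exists_separating_scale μ P (ε := ε / b) (by positivity)
  obtain ⟨l, hl, hll⟩ := exists_tail_exp_sum_le hε
  obtain ⟨l', D, hDm, hDμ, hD⟩ := exists_large_dynBall_set hT.measurable μ (hz' r hr) l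
    (ε := ε / B) (by positivity)
  refine (partitionEntropy_le_of_coding hT P hEm hDm hr hE hab hε.le hb.le hz0 hε.le hB.le hkB hl
    (hll l') hD).trans (EReal.coe_le_coe_iff.2 ?_)
  rw [le_div_iff₀ hb] at hEμ
  rw [le_div_iff₀ hB] at hDμ
  linarith

end LowerBound

/-! ### Inverse charts are locally Lipschitz -/

section Riemannian

open Manifold Metric Bundle

attribute [local instance] normedAddCommGroupTangentSpaceVectorSpace
attribute [local instance] normedSpaceTangentSpaceVectorSpace

variable {E : Type*} [NormedAddCommGroup E] [NormedSpace ℝ E]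
  {H : Type*} [TopologicalSpace H] (I : ModelWithCorners ℝ E H)
  {M : Type*} [TopologicalSpace M] [ChartedSpace H M]
  [RiemannianBundle (fun (x : M) ↦ TangentSpace I x)]
  [IsManifold I 1 M] [IsContinuousRiemannianBundle E (fun (x : M) ↦ TangentSpace I x)]

/-- The inverse chart has bounded derivative near the base point, so it maps a straight segment to a
curve of length at most `C` times that of the segment. Convexity of `range I` keeps the segment in
the chart; both endpoints are free, as covering estimates require. -/
lemma exists_riemannianEDist_symm_le (x : M) :
    ∃ C > (0 : ℝ≥0), ∃ r > 0,
      ball (extChartAt I x x) r ∩ range I ⊆ (extChartAt I x).target ∧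
      ∀ u ∈ ball (extChartAt I x x) r ∩ range I, ∀ v ∈ ball (extChartAt I x x) r ∩ range I,
    riemannianEDist I ((extChartAt I x).symm u) ((extChartAt I x).symm v) ≤ C * edist u v := by
  rcases eventually_enorm_mfderivWithin_symm_extChartAt_lt I x with ⟨C, C_pos, hC⟩
  obtain ⟨S, hS, hSC⟩ := eventually_iff_exists_mem.1 hC
  obtain ⟨r, r_pos, hr⟩ : ∃ r > 0,
      ball (extChartAt I x x) r ∩ range I ⊆ (extChartAt I x).target ∩
        S :=
    mem_nhdsWithin_iff.1 (inter_mem (extChartAt_target_mem_nhdsWithin x) hS)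
  refine ⟨C, C_pos, r, r_pos, hr.trans inter_subset_left, fun u hu v hv => ?_⟩
  let η := ContinuousAffineMap.lineMap (R := ℝ) u v
  set γ := (extChartAt I x).symm ∘ η
  have hη : Icc 0 1 ⊆ ⇑η ⁻¹' ((extChartAt I x).target ∩
        S) := by
    simp only [← image_subset_iff, ContinuousAffineMap.coe_lineMap_eq,
     ← segment_eq_image_lineMap, η]
    apply Subset.trans _ hr
    exact ((convex_ball _ _).inter I.convex_range).segment_subset hu hv
  simp only [preimage_inter, subset_inter_iff] at hη
  have η_smooth : CMDiff[Icc 0 1] 1 η := by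
    apply ContMDiff.contMDiffOn
    rw [contMDiff_iff_contDiff]
    exact ContinuousAffineMap.contDiff _
  have : riemannianEDist I ((extChartAt I x).symm u) ((extChartAt I x).symm v) ≤
      pathELength I γ 0 1 := by
    apply riemannianEDist_le_pathELength _ _ _ zero_le_one
    · exact (contMDiffOn_extChartAt_symm x).comp η_smooth hη.1
    · simp [γ, η, ContinuousAffineMap.coe_lineMap_eq]
    · simp [γ, η, ContinuousAffineMap.coe_lineMap_eq]
  apply this.trans
  rw [← lintegral_fderiv_lineMap_eq_edist, pathELength_eq_lintegral_mfderivWithin_Icc,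
    ← lintegral_const_mul' _ _ ENNReal.coe_ne_top]
  apply setLIntegral_mono' measurableSet_Icc (fun t ht ↦ ?_)
  have : mfderiv[Icc 0 1] γ t =
      (mfderiv[range I] (extChartAt I x).symm (η t)) ∘L (mfderiv[Icc 0 1] η t) := by
    apply mfderivWithin_comp
    · exact mdifferentiableWithinAt_extChartAt_symm (hη.1 ht)
    · exact η_smooth.mdifferentiableOn one_ne_zero t ht
    · exact hη.1.trans (preimage_mono (extChartAt_target_subset_range x))
    · rw [uniqueMDiffWithinAt_iff_uniqueDiffWithinAt]
      exact uniqueDiffOn_Icc zero_lt_one t ht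
  have : mfderiv[Icc 0 1] γ t 1 =
      (mfderiv[range I] (extChartAt I x).symm (η t)) (mfderiv[Icc 0 1] η t 1) := congr($this 1)
  rw [this]
  apply (ContinuousLinearMap.le_opENorm _ _).trans
  gcongr
  · exact (hSC _ (hη.2 ht)).le
  · simp only [mfderivWithin_eq_fderivWithin]
    exact le_of_eq rfl

end Riemannian

/-! ### Polynomial covering numbers -/

section Covering

/-- A set with polynomially growing covering numbers, of degree at most `D`. -/
def HasPolynomialCover {X : Type*} [MetricSpace X] (D : ℕ) (S : Set X) : Prop :=
  ∃ A : ℝ, ∀ s, 0 < s → s ≤ 1 → ∃ F : Finset X, (F.card : ℝ) ≤ A * (1 / s) ^ D ∧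
    ∀ x ∈ S, ∃ z ∈ F, dist x z < s

theorem HasPolynomialCover.mono {X : Type*} [MetricSpace X] {D : ℕ} {S S' : Set X}
    (h : HasPolynomialCover D S') (hS : S ⊆ S') : HasPolynomialCover D S := by
  obtain ⟨A, hA⟩ := h
  refine ⟨A, fun s h0 h1 => ?_⟩
  obtain ⟨F, hF, hc⟩ := hA s h0 h1
  exact ⟨F, hF, fun x hx => hc x (hS hx)⟩

theorem HasPolynomialCover.union {X : Type*} [MetricSpace X] {D : ℕ} {S S' : Set X}
    (h : HasPolynomialCover D S) (h' : HasPolynomialCover D S') :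
    HasPolynomialCover D (S ∪ S') := by
  classical
  obtain ⟨A, hA⟩ := h
  obtain ⟨A', hA'⟩ := h'
  refine ⟨A + A', fun s h0 h1 => ?_⟩
  obtain ⟨F, hF, hc⟩ := hA s h0 h1
  obtain ⟨F', hF', hc'⟩ := hA' s h0 h1
  refine ⟨F ∪ F', ?_, ?_⟩
  · have : ((F ∪ F').card : ℝ) ≤ F.card + F'.card := by exact_mod_cast Finset.card_union_le _ _
    linarith
  · rintro x (hx | hx)
    · obtain ⟨z, hz, hd⟩ := hc x hx
      exact ⟨z, Finset.mem_union_left _ hz, hd⟩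
    · obtain ⟨z, hz, hd⟩ := hc' x hx
      exact ⟨z, Finset.mem_union_right _ hz, hd⟩

/-- Rounding down to a grid of mesh `δ / m`. The node must itself stay within `δ` of `a`, since the
map to be covered is Lipschitz only there. -/
theorem exists_grid_close {δ : ℝ} (hδ : 0 < δ) (a u : ℝ) (hu : |u - a| ≤ δ) {m : ℕ}
    (hm : 1 ≤ m) : ∃ j : Fin (2 * m + 1), |u - (a + δ * ((j : ℝ) - m) / m)| ≤ δ / m ∧
      |(a + δ * ((j : ℝ) - m) / m) - a| ≤ δ := by
  have hm' : (0 : ℝ) < m := by exact_mod_cast hm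
  obtain ⟨h1, h2⟩ := abs_le.1 hu
  have h3 : 0 ≤ (u - a) * m / δ + m := by
    have : -δ * m / δ ≤ (u - a) * m / δ := by gcongr
    have h4 : -δ * m / δ = -m := by field_simp
    linarith
  have h5 : (u - a) * m / δ + m ≤ 2 * m := by
    have : (u - a) * m / δ ≤ δ * m / δ := by gcongr
    have h4 : δ * m / δ = m := by field_simp
    linarith
  have hfl := Nat.floor_le h3
  have hfl' := Nat.lt_floor_add_one ((u - a) * m / δ + m)
  have hlt : ⌊(u - a) * m / δ + m⌋₊ < 2 * m + 1 := by
    have : (⌊(u - a) * m / δ + m⌋₊ : ℝ) < (2 * m + 1 : ℕ) := by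
      push_cast
      linarith
    exact_mod_cast this
  refine ⟨⟨_, hlt⟩, ?_, ?_⟩
  · have e : u - (a + δ * ((⌊(u - a) * m / δ + m⌋₊ : ℝ) - m) / m) =
        δ / m * ((u - a) * m / δ + m - (⌊(u - a) * m / δ + m⌋₊ : ℝ)) := by
      field_simp
      ring
    simp only
    rw [e, abs_mul, abs_of_pos (by positivity : 0 < δ / m), abs_of_nonneg (by linarith)]
    have : 0 < δ / m := by positivity
    nlinarith
  · have e : a + δ * ((⌊(u - a) * m / δ + m⌋₊ : ℝ) - m) / m - a =
        δ / m * ((⌊(u - a) * m / δ + m⌋₊ : ℝ) - m) := by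
      field_simp
      ring
    simp only
    rw [e, abs_mul, abs_of_pos (by positivity : 0 < δ / m)]
    have h6 : |(⌊(u - a) * m / δ + m⌋₊ : ℝ) - m| ≤ m := by
      have h7 : (0 : ℝ) ≤ ⌊(u - a) * m / δ + m⌋₊ := Nat.cast_nonneg _
      exact abs_le.2 ⟨by linarith, by linarith⟩
    calc δ / m * |(⌊(u - a) * m / δ + m⌋₊ : ℝ) - m| ≤ δ / m * m := by gcongr
      _ = δ := by field_simp

theorem hasPolynomialCover_image_closedBall {X : Type*} [MetricSpace X] {d : ℕ}
    (f : (Fin d → ℝ) → X) (a : Fin d → ℝ) {δ L : ℝ} (hδ : 0 < δ) (hL : 0 ≤ L)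
    (hf : ∀ u ∈ Metric.closedBall a δ, ∀ v ∈ Metric.closedBall a δ,
      dist (f u) (f v) ≤ L * dist u v) :
    HasPolynomialCover d (f '' Metric.closedBall a δ) := by
  classical
  refine ⟨(2 * (L * δ) + 5) ^ d, fun s h0 h1 => ?_⟩
  -- The `+ 1` gives `m ≥ 1` and a strict bound `L * δ / m < s`, also when `L = 0`.
  let m : ℕ := ⌈L * δ / s⌉₊ + 1
  have hm : 1 ≤ m := Nat.le_add_left _ _
  have hm' : (0 : ℝ) < m := by exact_mod_cast hm
  have hm1 : L * δ / s < m := by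
    have := Nat.le_ceil (L * δ / s)
    simp only [m]
    push_cast
    linarith
  have hm2 : (m : ℝ) < L * δ / s + 2 := by
    have := Nat.ceil_lt_add_one (show 0 ≤ L * δ / s by positivity)
    simp only [m]
    push_cast
    linarith
  let g : (Fin d → Fin (2 * m + 1)) → X := fun j => f fun i => a i + δ * ((j i : ℝ) - m) / m
  refine ⟨Finset.univ.image g, ?_, ?_⟩
  · calc ((Finset.univ.image g).card : ℝ) ≤ ((2 * m + 1) ^ d : ℕ) := by
          have := Finset.card_image_le (s := Finset.univ) (f := g)
          simp only [Finset.card_univ, Fintype.card_fun, Fintype.card_fin] at this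
          exact_mod_cast this
      _ = (2 * m + 1 : ℝ) ^ d := by push_cast; ring
      _ ≤ ((2 * (L * δ) + 5) * (1 / s)) ^ d := by
          refine pow_le_pow_left₀ (by positivity) ?_ d
          have h2 : 1 ≤ 1 / s := by rw [le_div_iff₀ h0]; linarith
          have h3 : (2 * (L * δ) + 5) * (1 / s) = 2 * (L * δ / s) + 5 * (1 / s) := by ring
          linarith
      _ = _ := mul_pow _ _ _
  · rintro _ ⟨u, hu, rfl⟩
    have hu' := fun i => (dist_pi_le_iff hδ.le).1 hu i
    choose j hj1 hj2 using fun i => exists_grid_close hδ (a i) (u i) (hu' i) hm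
    refine ⟨g j, Finset.mem_image_of_mem _ (Finset.mem_univ _), ?_⟩
    calc dist (f u) (g j) ≤ L * dist u fun i => a i + δ * ((j i : ℝ) - m) / m :=
          hf _ hu _ ((dist_pi_le_iff hδ.le).2 hj2)
      _ ≤ L * (δ / m) := by
          refine mul_le_mul_of_nonneg_left ?_ hL
          exact (dist_pi_le_iff (by positivity)).2 hj1
      _ = L * δ / m := by ring
      _ < s := by rwa [div_lt_comm₀ hm' h0]

theorem IsCompact.hasPolynomialCover {X : Type*} [MetricSpace X] {D : ℕ} {K : Set X}
    (hK : IsCompact K) (h : ∀ x ∈ K, ∃ S ∈ 𝓝 x, HasPolynomialCover D S) :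
    HasPolynomialCover D K := by
  refine hK.induction_on (p := fun S => HasPolynomialCover D S) ?_
    (fun s t hst ht => ht.mono hst) (fun s t hs ht => hs.union ht) fun x hx => ?_
  · exact ⟨0, fun s _ _ => ⟨∅, by simp, by simp⟩⟩
  · obtain ⟨S, hS, hp⟩ := h x hx
    exact ⟨S, mem_nhdsWithin_of_mem_nhds hS, hp⟩

end Covering

/-! ### Separability of connected locally compact metric spaces -/

section Separable

/-- Starting from one point, repeatedly add countable sets whose closures contain all separable
balls of rational radius around the points already present. The closure of the union is open by
local compactness, hence everything. -/
theorem separableSpace_of_connected_of_locallyCompact (X : Type*) [MetricSpace X]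
    [LocallyCompactSpace X] [PreconnectedSpace X] : TopologicalSpace.SeparableSpace X := by
  rcases isEmpty_or_nonempty X with hX | ⟨⟨x₀⟩⟩
  · infer_instance
  have hnext : ∀ A : {A : Set X // A.Countable}, ∃ B : {B : Set X // B.Countable},
      ∀ x ∈ A.1, ∀ ρ : ℚ, TopologicalSpace.IsSeparable (Metric.ball x (ρ : ℝ)) →
        Metric.ball x (ρ : ℝ) ⊆ closure B.1 := by
    rintro ⟨A, hA⟩
    have : TopologicalSpace.IsSeparable (⋃ x ∈ A, ⋃ ρ : ℚ,
        ⋃ _ : TopologicalSpace.IsSeparable (Metric.ball x (ρ : ℝ)), Metric.ball x (ρ : ℝ)) := by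
      have := hA.to_subtype
      rw [Set.biUnion_eq_iUnion]
      exact TopologicalSpace.IsSeparable.iUnion fun _ => TopologicalSpace.IsSeparable.iUnion
        fun _ => TopologicalSpace.IsSeparable.iUnion fun h => h
    obtain ⟨B, hB, hsub⟩ := this
    refine ⟨⟨B, hB⟩, fun x hx ρ hρ => Subset.trans ?_ hsub⟩
    intro y hy
    exact Set.mem_iUnion₂.2 ⟨x, hx, Set.mem_iUnion₂.2 ⟨ρ, hρ, hy⟩⟩
  choose next hn using hnext
  let A : ℕ → {A : Set X // A.Countable} := fun n => next^[n] ⟨{x₀}, countable_singleton x₀⟩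
  have hA : ∀ n, A (n + 1) = next (A n) := fun n => Function.iterate_succ_apply' _ _ _
  have hclosed : IsClosed (closure (⋃ n, (A n).1)) := isClosed_closure
  have hopen : IsOpen (closure (⋃ n, (A n).1)) := by
    rw [isOpen_iff_mem_nhds]
    intro y hy
    obtain ⟨C, hC, hCy⟩ := exists_compact_mem_nhds y
    obtain ⟨ε, hε, hεC⟩ := Metric.mem_nhds_iff.1 hCy
    obtain ⟨x, hx, hxy⟩ := Metric.mem_closure_iff.1 hy (ε / 4) (by positivity)
    obtain ⟨n, hxn⟩ := Set.mem_iUnion.1 hx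
    -- Large enough for the ball about `x` to contain `y`, small enough for it to lie in the compact
    -- neighbourhood of `y`.
    obtain ⟨ρ, hρ1, hρ2⟩ := exists_rat_btwn (show ε / 4 < ε / 2 by linarith)
    have hsub : Metric.ball x (ρ : ℝ) ⊆ Metric.ball y ε := by
      refine Metric.ball_subset_ball' ?_
      rw [dist_comm]
      linarith
    have hcl := hn (A n) x hxn ρ (hC.isSeparable.mono (hsub.trans hεC))
    rw [← hA] at hcl
    refine Filter.mem_of_superset (Metric.isOpen_ball.mem_nhds (?_ : y ∈ Metric.ball x (ρ : ℝ)))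
      (hcl.trans (closure_mono (Set.subset_iUnion (fun n => (A n).1) (n + 1))))
    rw [Metric.mem_ball]
    linarith
  have huniv := IsClopen.eq_univ ⟨hclosed, hopen⟩
    ⟨x₀, subset_closure (Set.mem_iUnion.2 ⟨0, Set.mem_singleton x₀⟩)⟩
  exact ⟨⟨_, Set.countable_iUnion fun n => (A n).2, dense_iff_closure_eq.2 huniv⟩⟩

end Separable

/-! ### Connectedness from finite Riemannian distance -/

section Connected

open Manifold Bundle

/-- The distance of a metric space is finite, so any two points are joined by a curve of finite
length. -/
theorem preconnectedSpace_of_isRiemannianManifold (d : ℕ) (M : Type*) [MetricSpace M]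
    [ChartedSpace (EuclideanSpace ℝ (Fin d)) M]
    [RiemannianBundle (fun x : M => TangentSpace (𝓡 d) x)] [IsRiemannianManifold (𝓡 d) M] :
    PreconnectedSpace M := by
  refine ⟨isPreconnected_of_forall_pair fun x _ y _ => ?_⟩
  have hlt : riemannianEDist (𝓡 d) x y < ⊤ := by
    rw [← IsRiemannianManifold.out]
    exact edist_lt_top x y
  obtain ⟨γ, h0, h1, hγ, -⟩ := exists_lt_of_riemannianEDist_lt hlt
  refine ⟨γ '' Icc 0 1, subset_univ _, ⟨0, by simp, h0⟩, ⟨1, by simp, h1⟩, ?_⟩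
  exact isPreconnected_Icc.image _ hγ.continuousOn

end Connected

/-! ### Covering numbers of compact subsets of a manifold -/

section RiemannianConsequences

open Manifold Metric Bundle

variable {d : ℕ} {M : Type*} [MetricSpace M]
  [ChartedSpace (EuclideanSpace ℝ (Fin d)) M] [IsManifold (𝓡 d) 1 M]
  [RiemannianBundle (fun x : M => TangentSpace (𝓡 d) x)]
  [IsContinuousRiemannianBundle (EuclideanSpace ℝ (Fin d)) (fun x : M => TangentSpace (𝓡 d) x)]
  [IsRiemannianManifold (𝓡 d) M]

/-- Each point has a neighbourhood which is a Lipschitz image of a ball in `ℝᵈ`. The grid lives in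
the sup norm, hence the passage through `e` and its operator norm in the constant. -/
theorem IsCompact.hasPolynomialCover_of_isRiemannianManifold {K : Set M} (hK : IsCompact K) :
    HasPolynomialCover d K := by
  refine hK.hasPolynomialCover fun x _ => ?_
  obtain ⟨C, hC0, r, hr, hsub, hC⟩ := exists_riemannianEDist_symm_le (𝓡 d) x
  let e := EuclideanSpace.equiv (Fin d) ℝ
  obtain ⟨δ, hδ, hδr⟩ := Metric.nhds_basis_closedBall.mem_iff.1
    (e.symm.continuous.continuousAt.preimage_mem_nhds (x := e (extChartAt (𝓡 d) x x))
      (by rw [e.symm_apply_apply]; exact ball_mem_nhds _ hr))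
  refine ⟨_, ?_, hasPolynomialCover_image_closedBall
    (fun u => (extChartAt (𝓡 d) x).symm (e.symm u)) (e (extChartAt (𝓡 d) x x)) (δ := δ)
    (L := C * ‖(e.symm : (Fin d → ℝ) →L[ℝ] EuclideanSpace ℝ (Fin d))‖) hδ (by positivity) ?_⟩
  · have h1 : ∀ᶠ y in 𝓝 x, e (extChartAt (𝓡 d) x y) ∈
        closedBall (e (extChartAt (𝓡 d) x x)) δ :=
      (e.continuous.continuousAt.comp (continuousAt_extChartAt (I := 𝓡 d) x)).preimage_mem_nhds
        (closedBall_mem_nhds _ hδ)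
    filter_upwards [h1, extChartAt_source_mem_nhds (I := 𝓡 d) x] with y hy hys
    refine ⟨_, hy, ?_⟩
    simp only [e.symm_apply_apply]
    exact (extChartAt (𝓡 d) x).left_inv hys
  · intro u hu v hv
    have hrange : range (𝓡 d) = univ := by simp
    have h := hC (e.symm u) ⟨hδr hu, by rw [hrange]; trivial⟩ (e.symm v)
      ⟨hδr hv, by rw [hrange]; trivial⟩
    rw [← IsRiemannianManifold.out, edist_dist, edist_dist, ← ENNReal.ofReal_coe_nnreal,
      ← ENNReal.ofReal_mul (by positivity), ENNReal.ofReal_le_ofReal_iff (by positivity)] at h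
    refine h.trans ?_
    rw [mul_assoc]
    refine mul_le_mul_of_nonneg_left ?_ (by positivity)
    rw [dist_eq_norm, dist_eq_norm, ← map_sub]
    exact (e.symm : (Fin d → ℝ) →L[ℝ] EuclideanSpace ℝ (Fin d)).le_opNorm _

end RiemannianConsequences

/-! ### Return times and Kac's inequality -/

section ReturnTime

variable {X : Type*}

/-- The first return time to `K`, with value `0` for points which never return. -/
def returnTime (T : X → X) (K : Set X) (x : X) : ℕ := sInf {m | 1 ≤ m ∧ T^[m] x ∈ K}

theorem iterate_returnTime_mem {T : X → X} {K : Set X} {x : X}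
    (h : ∃ m, 1 ≤ m ∧ T^[m] x ∈ K) : 1 ≤ returnTime T K x ∧ T^[returnTime T K x] x ∈ K :=
  Nat.sInf_mem (s := {m | 1 ≤ m ∧ T^[m] x ∈ K}) h

theorem notMem_of_lt_returnTime {T : X → X} {K : Set X} {x : X} {m : ℕ} (h1 : 1 ≤ m)
    (hm : m < returnTime T K x) : T^[m] x ∉ K :=
  fun h => Nat.notMem_of_lt_sInf hm ⟨h1, h⟩

variable [MeasurableSpace X]

theorem measurable_returnTime {T : X → X} (hT : Measurable T) {K : Set X}
    (hK : MeasurableSet K) : Measurable (returnTime T K) := by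
  have hS : ∀ m, MeasurableSet {x | 1 ≤ m ∧ T^[m] x ∈ K} := fun m =>
    (MeasurableSet.const (1 ≤ m)).inter ((hT.iterate m) hK)
  refine measurable_of_Ioi fun n => ?_
  -- The union discards points that never return: their return time is `sInf ∅ = 0`.
  have : returnTime T K ⁻¹' Ioi n = (⋃ m, {x | 1 ≤ m ∧ T^[m] x ∈ K}) ∩
      ⋂ m ∈ Finset.range (n + 1), {x | 1 ≤ m ∧ T^[m] x ∈ K}ᶜ := by
    ext x
    simp only [mem_preimage, mem_Ioi, mem_inter_iff, mem_iUnion, mem_iInter, Finset.mem_range,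
      mem_compl_iff]
    constructor
    · intro h
      refine ⟨?_, fun m hm hmem => Nat.notMem_of_lt_sInf (lt_of_lt_of_le hm h) hmem⟩
      by_contra hne
      push Not at hne
      have : returnTime T K x = 0 := by
        refine Nat.sInf_eq_zero.2 (Or.inr (Set.eq_empty_of_forall_notMem fun m hm => hne m hm))
      omega
    · rintro ⟨hex, hall⟩
      by_contra hlt
      exact hall _ (by omega) (iterate_returnTime_mem hex)
  rw [this]
  exact (MeasurableSet.iUnion hS).inter (Finset.measurableSet_biInter _ fun m _ => (hS m).compl)

/-- Kac's inequality. -/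
theorem setLIntegral_returnTime_le_one {T : X → X} {μ : Measure X} [IsProbabilityMeasure μ]
    (hT : MeasurePreserving T μ μ) {K : Set X} (hK : MeasurableSet K) :
    ∫⁻ x in K, (returnTime T K x : ℝ≥0∞) ∂μ ≤ 1 := by
  let F : ℕ → Set X := fun m => ⋂ i ∈ Finset.range m, (T^[i] ⁻¹' K)ᶜ
  have hF : ∀ m, MeasurableSet (F m) := fun m =>
    Finset.measurableSet_biInter _ fun i _ => ((hT.measurable.iterate i) hK).compl
  let E : ℕ → Set X := fun m => K ∩ T ⁻¹' F m
  have hE : ∀ m, MeasurableSet (E m) := fun m => hK.inter (hT.measurable (hF m))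
  -- `T ⁻¹' F m` has the measure of `F m`; its part in `K` is `E m` and its part outside `K` is `F
  -- (m + 1)`. The identity telescopes.
  have hEF : ∀ m, μ (E m) + μ (F (m + 1)) = μ (F m) := by
    intro m
    have h1 : F (m + 1) = T ⁻¹' F m \ K := by
      ext x
      simp only [F, mem_iInter, Finset.mem_range, mem_compl_iff, mem_preimage, Set.mem_sdiff,
        ← Function.iterate_succ_apply]
      constructor
      · exact fun h => ⟨fun i hi => h (i + 1) (by omega), h 0 (by omega)⟩
      · rintro ⟨h1, h2⟩ (_ | i) hi
        · exact h2
        · exact h1 i (by omega)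
    rw [h1, ← hT.measure_preimage (hF m).nullMeasurableSet]
    simp only [E]
    rw [inter_comm]
    exact measure_inter_add_sdiff _ hK
  have hsum : ∀ n, ∑ m ∈ Finset.range n, μ (E m) + μ (F n) = 1 := by
    intro n
    induction n with
    | zero => simp [F]
    | succ n ih => rw [Finset.sum_range_succ, add_assoc, hEF, ih]
  have hsum' : ∑' m, μ (E m) ≤ 1 := by
    refine ENNReal.tsum_le_of_sum_range_le fun n => ?_
    rw [← hsum n]
    exact le_self_add
  calc ∫⁻ x in K, (returnTime T K x : ℝ≥0∞) ∂μ
      ≤ ∫⁻ x in K, ∑' m, (E m).indicator 1 x ∂μ := by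
        refine setLIntegral_mono' hK fun x hx => ?_
        -- A point of `K` lies in `E m` for every `m` below its return time.
        refine le_trans ?_ (ENNReal.sum_le_tsum (Finset.range (returnTime T K x)))
        rw [Finset.sum_congr rfl fun m hm => indicator_of_mem (f := (1 : X → ℝ≥0∞))
          (show x ∈ E m from ⟨hx, ?_⟩)]
        · simp
        · simp only [F, mem_preimage, mem_iInter, Finset.mem_range, mem_compl_iff,
            ← Function.iterate_succ_apply]
          intro i hi
          exact notMem_of_lt_returnTime (by omega) (by have := Finset.mem_range.1 hm; omega)
    _ ≤ ∫⁻ x, ∑' m, (E m).indicator 1 x ∂μ := setLIntegral_le_lintegral _ _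
    _ = ∑' m, μ (E m) := by
        rw [lintegral_tsum fun m => (measurable_one.indicator (hE m)).aemeasurable]
        exact tsum_congr fun m => lintegral_indicator_one (hE m)
    _ ≤ 1 := hsum'

theorem ae_forall_exists_return {T : X → X} {μ : Measure X} [IsFiniteMeasure μ]
    (hT : MeasurePreserving T μ μ) {K : Set X} (hK : MeasurableSet K) :
    ∀ᵐ x ∂μ, ∀ j, T^[j] x ∈ K → ∃ m, 1 ≤ m ∧ T^[m] (T^[j] x) ∈ K := by
  filter_upwards [hT.conservative.ae_forall_image_mem_imp_frequently_image_mem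
    hK.nullMeasurableSet] with x hx j hj
  obtain ⟨n, hn, hnK⟩ := frequently_atTop.1 (hx j hj) (j + 1)
  refine ⟨n - j, by omega, ?_⟩
  rwa [← Function.iterate_add_apply, Nat.sub_add_cancel (by omega)]

end ReturnTime

/-! ### Functions that do not increase along orbits -/

section Ergodic

/-- Each sublevel set `{f < b}` is almost contained in its preimage, hence null or full. For `b > β`
it cannot be null, as the integral would then be at least `b`. -/
theorem Ergodic.ae_le_of_comp_le_of_lintegral_le {X : Type*} [MeasurableSpace X] {μ : Measure X}
    [IsProbabilityMeasure μ] {T : X → X} (hT : Ergodic T μ) {f : X → ℝ≥0∞} (hf : Measurable f)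
    (hfT : ∀ᵐ x ∂μ, f (T x) ≤ f x) {β : ℝ≥0∞} (hβ : ∫⁻ x, f x ∂μ ≤ β) :
    ∀ᵐ x ∂μ, f x ≤ β := by
  rcases eq_or_ne β ⊤ with rfl | hβt
  · simp
  have key : ∀ b, β < b → ∀ᵐ x ∂μ, f x < b := by
    intro b hb
    have hm : MeasurableSet {x | f x < b} := measurableSet_lt hf measurable_const
    have hsub : {x | f x < b} ≤ᵐ[μ] T ⁻¹' {x | f x < b} := by
      filter_upwards [hfT] with x hx hxb
      exact lt_of_le_of_lt hx hxb
    rcases hT.ae_empty_or_univ_of_ae_le_preimage hm.nullMeasurableSet hsub with h | h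
    · exfalso
      have h1 : ∀ᵐ x ∂μ, b ≤ f x := by
        filter_upwards [h.mem_iff] with x hx
        exact not_lt.1 fun hlt => hx.1 hlt
      have h2 : b ≤ ∫⁻ x, f x ∂μ := by
        calc b = ∫⁻ _, b ∂μ := by simp
          _ ≤ _ := lintegral_mono_ae h1
      exact absurd (h2.trans hβ) (not_le.2 hb)
    · filter_upwards [h.mem_iff] with x hx
      exact hx.2 trivial
  obtain ⟨u, -, hu, hlim⟩ := exists_seq_strictAnti_tendsto' (hβt.lt_top)
  filter_upwards [ae_all_iff.2 fun n => key (u n) (hu n).1] with x hx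
  exact ge_of_tendsto' hlim fun n => (hx n).le

end Ergodic

/-! ### Lower bounds for joint cylinders -/

section WordWeights

theorem ENNReal.tsum_prod_word {ι : Type*} : ∀ {n : ℕ} (f : Fin n → ι → ℝ≥0∞),
    ∑' u : Fin n → ι, ∏ i, f i (u i) = ∏ i, ∑' a, f i a
  | 0, f => by simp
  | n + 1, f => by
    rw [← (Fin.consEquiv fun _ => ι).tsum_eq, ENNReal.tsum_prod', Fin.prod_univ_succ,
      ← ENNReal.tsum_prod_word fun i => f i.succ, ← ENNReal.tsum_mul_right]
    refine tsum_congr fun a => ?_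
    rw [← ENNReal.tsum_mul_left]
    refine tsum_congr fun u => ?_
    rw [Fin.prod_univ_succ]
    simp [Fin.consEquiv]

/-- Almost surely, the measure of the cylinder of `x` for the joint itinerary with respect to the
partition `P` and a countable labelling `b` is eventually, up to a subexponential factor, at least
any given conditional weight. -/
theorem ae_eventually_weight_le {X : Type*} [MeasurableSpace X] (μ : Measure X)
    [IsProbabilityMeasure μ] {T : X → X} (hT : Measurable T) {k : ℕ}
    (P : FinMeasurablePartition X k) {ι : Type*} [Countable ι] (b : X → ι)
    (ρ : Fin k → ι → ℝ≥0∞) (hρ : ∀ v, ∑' u, ρ v u ≤ 1) {ε : ℝ} (hε : 0 < ε) :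
    ∀ᵐ x ∂μ, ∀ᶠ n : ℕ in atTop, ENNReal.ofReal (Real.exp (-(n * ε))) *
      (μ (refinedAtom T P n (P.word T n x)) *
        ∏ i : Fin n, ρ (P.label (T^[(i : ℕ)] x)) (b (T^[(i : ℕ)] x))) ≤
      μ {y | P.word T n y = P.word T n x ∧ ∀ i < n, b (T^[i] y) = b (T^[i] x)} := by
  let q : ∀ n, (Fin n → Fin k) × (Fin n → ι) → ℝ≥0∞ := fun n p =>
    μ (refinedAtom T P n p.1) * ∏ i : Fin n, ρ (p.1 i) (p.2 i)
  let A : ∀ n, (Fin n → Fin k) × (Fin n → ι) → Set X := fun n p =>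
    {y | P.word T n y = p.1 ∧ (fun i : Fin n => b (T^[(i : ℕ)] y)) = p.2}
  let e : ℕ → ℝ≥0∞ := fun n => ENNReal.ofReal (Real.exp (-(n * ε)))
  have hq : ∀ n, ∑' p, q n p ≤ 1 := by
    intro n
    rw [ENNReal.tsum_prod', tsum_fintype]
    calc ∑ v, ∑' u, q n (v, u) ≤ ∑ v, μ (refinedAtom T P n v) := by
          refine Finset.sum_le_sum fun v _ => ?_
          simp only [q]
          rw [ENNReal.tsum_mul_left, ENNReal.tsum_prod_word fun i => ρ (v i)]
          exact mul_le_of_le_one_right' (Finset.prod_le_one' fun i _ => hρ _)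
      _ = μ (⋃ v, refinedAtom T P n v) := by
          rw [measure_iUnion (refinedAtom_disjoint T P n) (measurableSet_refinedAtom hT P n),
            tsum_fintype]
      _ ≤ 1 := prob_le_one
  -- The cylinders violating the bound have total mass at most `e n`, because `q n` is a
  -- subprobability. Since `e n` is summable, Borel–Cantelli applies.
  let bad : ℕ → Set X := fun n => ⋃ p : {p // μ (A n p) < e n * q n p}, A n p.1
  have hbad : ∀ n, μ (bad n) ≤ e n := by
    intro n
    calc μ (bad n) ≤ ∑' p : {p // μ (A n p) < e n * q n p}, μ (A n p.1) := measure_iUnion_le _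
      _ ≤ ∑' p : {p // μ (A n p) < e n * q n p}, e n * q n p.1 :=
          ENNReal.tsum_le_tsum fun p => p.2.le
      _ ≤ ∑' p, e n * q n p := ENNReal.tsum_comp_le_tsum_of_injective Subtype.val_injective _
      _ ≤ e n := by
          rw [ENNReal.tsum_mul_left]
          exact mul_le_of_le_one_right' (hq n)
  have hsum : ∑' n, μ (bad n) ≠ ⊤ := by
    have hs : Summable fun n : ℕ => Real.exp (-(n * ε)) := by
      have := Real.summable_exp_nat_mul_iff.2 (neg_lt_zero.2 hε)
      simpa [mul_neg] using this
    exact ne_top_of_le_ne_top hs.tsum_ofReal_ne_top (ENNReal.tsum_le_tsum hbad)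
  filter_upwards [ae_eventually_notMem hsum] with x hx
  filter_upwards [hx] with n hn
  have hA : {y | P.word T n y = P.word T n x ∧ ∀ i < n, b (T^[i] y) = b (T^[i] x)} =
      A n (P.word T n x, fun i => b (T^[(i : ℕ)] x)) := by
    ext y
    simp only [A, mem_ofPred_eq, funext_iff, Fin.forall_iff]
  rw [hA]
  by_contra! hlt
  exact hn (mem_iUnion.2 ⟨⟨_, hlt⟩, rfl, rfl⟩)

end WordWeights

/-! ### Labels at exponentially small scales -/

section Labels

/-- Label a point by the index of a nearest point in a net of scale `ρ / C ^ m`. A polynomial in `C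
^ m` is exponential in `m`, which makes the cost of a label linear in `m`. -/
theorem HasPolynomialCover.exists_label {X : Type*} [MetricSpace X] [MeasurableSpace X]
    [BorelSpace X] [Nonempty X] {D : ℕ} {K : Set X} (hK : HasPolynomialCover D K) {C r : ℝ}
    (hC : 1 ≤ C) (hr : 0 < r) :
    ∃ (α : ℝ) (l : ℕ → X → ℕ) (N : ℕ → ℕ), 0 ≤ α ∧ (∀ m, Measurable (l m)) ∧
      (∀ m x, l m x < N m) ∧ (∀ m, (N m : ℝ) ≤ Real.exp (α * (m + 1))) ∧
      ∀ m, ∀ x ∈ K, ∀ y ∈ K, l m x = l m y → dist x y * C ^ m < r := by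
  classical
  obtain ⟨A, hA⟩ := hK
  let ρ := min r 1 / 2
  have hρ : 0 < ρ := by positivity
  have hρr : 2 * ρ ≤ r := by
    have := min_le_left r 1
    simp only [ρ]
    linarith
  have hρ1 : ρ ≤ 1 := by
    have := min_le_right r 1
    simp only [ρ]
    linarith
  have hCm : ∀ m : ℕ, 1 ≤ C ^ m := fun m => one_le_pow₀ hC
  have hs : ∀ m : ℕ, 0 < ρ / C ^ m ∧ ρ / C ^ m ≤ 1 := fun m =>
    ⟨div_pos hρ (by linarith [hCm m]), (div_le_self hρ.le (hCm m)).trans hρ1⟩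
  choose F hF hcov using fun m => hA _ (hs m).1 (hs m).2
  have henum : ∀ m, ∃ e : ℕ → X, ∀ z ∈ F m, ∃ i ≤ (F m).card, e i = z := by
    intro m
    refine ⟨fun i => if h : i < (F m).card then ((F m).equivFin.symm ⟨i, h⟩ : X) else
      Classical.arbitrary X, fun z hz => ?_⟩
    refine ⟨(F m).equivFin ⟨z, hz⟩, ((F m).equivFin ⟨z, hz⟩).2.le, ?_⟩
    simp
  choose e he using henum
  have hlog : ∃ α : ℝ, 0 ≤ α ∧ ∀ m : ℕ, ((F m).card + 1 : ℝ) ≤ Real.exp (α * (m + 1)) := by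
    -- The summand `1` absorbs the extra label, since `nearestPtInd` ranges over indices up to and
    -- including the cardinality. It also ensures `log a ≥ 0`.
    let a := |A| * (1 / ρ) ^ D + 1
    have ha : 1 ≤ a := by
      simp only [a]
      have : 0 ≤ |A| * (1 / ρ) ^ D := by positivity
      linarith
    have hlC : 0 ≤ Real.log C := Real.log_nonneg hC
    have hla : 0 ≤ Real.log a := Real.log_nonneg ha
    refine ⟨Real.log a + D * Real.log C, by positivity, fun m => ?_⟩
    have h1 : ((F m).card : ℝ) + 1 ≤ a * (C ^ m) ^ D := by
      have h2 : (F m).card ≤ |A| * (1 / ρ) ^ D * (C ^ m) ^ D := by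
        refine (hF m).trans ?_
        have : (1 / (ρ / C ^ m)) ^ D = (1 / ρ) ^ D * (C ^ m) ^ D := by
          rw [← mul_pow]
          congr 1
          field_simp
        rw [this, ← mul_assoc]
        gcongr
        exact le_abs_self A
      have h3 : 1 ≤ (C ^ m) ^ D := one_le_pow₀ (hCm m)
      simp only [a]
      linarith
    refine h1.trans ?_
    have h4 : a * (C ^ m) ^ D = Real.exp (Real.log a + D * Real.log C * m) := by
      rw [Real.exp_add, Real.exp_log (by linarith), ← pow_mul,
        show D * Real.log C * m = ((m * D : ℕ) : ℝ) * Real.log C by push_cast; ring,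
        Real.exp_nat_mul, Real.exp_log (by linarith)]
    rw [h4]
    refine Real.exp_le_exp.2 ?_
    have h5 : 0 ≤ Real.log a * m := by positivity
    have h6 : 0 ≤ D * Real.log C := by positivity
    linarith
  obtain ⟨α, hα, hαN⟩ := hlog
  refine ⟨α, fun m => SimpleFunc.nearestPtInd (e m) (F m).card, fun m => (F m).card + 1, hα,
    fun m => SimpleFunc.measurable _, fun m x => Nat.lt_succ_of_le
      (SimpleFunc.nearestPtInd_le _ _ _), fun m => by exact_mod_cast hαN m, ?_⟩
  have hclose : ∀ m, ∀ x ∈ K,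
      dist (e m (SimpleFunc.nearestPtInd (e m) (F m).card x)) x < ρ / C ^ m := by
    intro m x hx
    obtain ⟨z, hz, hxz⟩ := hcov m x hx
    obtain ⟨i, hi, rfl⟩ := he m z hz
    have := SimpleFunc.edist_nearestPt_le (e m) x hi
    rw [SimpleFunc.nearestPt, SimpleFunc.map_apply, edist_dist, edist_dist,
      ENNReal.ofReal_le_ofReal_iff dist_nonneg] at this
    rw [dist_comm] at hxz
    exact this.trans_lt hxz
  intro m x hx y hy hxy
  beta_reduce at hxy
  have h1 := hclose m x hx
  have h2 := hclose m y hy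
  rw [← hxy] at h2
  have h3 := dist_triangle_left x y (e m (SimpleFunc.nearestPtInd (e m) (F m).card x))
  have h4 : dist x y < 2 * ρ / C ^ m := by
    rw [mul_div_assoc]
    linarith
  rw [lt_div_iff₀ (by linarith [hCm m])] at h4
  linarith

end Labels

/-! ### A finite partition with a cheap residual label -/

section Partition

/-- The partition into the fibres of a bounded measurable function. -/
def FinMeasurablePartition.ofFibers {X : Type*} [MeasurableSpace X] {c : X → ℕ} {k : ℕ}
    (hc : Measurable c) (hk : ∀ x, c x < k) : FinMeasurablePartition X k where
  atom j := c ⁻¹' {(j : ℕ)}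
  measurableSet_atom j := hc (measurableSet_singleton _)
  disjoint_atom i j hij := by
    refine Set.disjoint_left.2 fun x hx hy => hij (Fin.ext ?_)
    exact (show c x = i from hx).symm.trans hy
  iUnion_atom := Set.eq_univ_of_forall fun x => Set.mem_iUnion.2 ⟨⟨c x, hk x⟩, rfl⟩

theorem FinMeasurablePartition.label_ofFibers {X : Type*} [MeasurableSpace X] {c : X → ℕ} {k : ℕ}
    (hc : Measurable c) (hk : ∀ x, c x < k) (x : X) :
    ((ofFibers hc hk).label x : ℕ) = c x := by
  have h : x ∈ (ofFibers hc hk).atom ⟨c x, hk x⟩ := rfl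
  rw [(ofFibers hc hk).mem_atom_iff.1 h]

theorem measurable_apply_index {X : Type*} [MeasurableSpace X] {τ : X → ℕ} (hτ : Measurable τ)
    {l : ℕ → X → ℕ} (hl : ∀ m, Measurable (l m)) : Measurable fun x => l (τ x) x :=
  (measurable_from_prod_countable_right fun m => hl m : Measurable fun p : ℕ × X => l p.1 p.2).comp
    (hτ.prodMk measurable_id)

/-- A probability weight on `ℕ`, seen as the set of codes of pairs `(m, j)`, which is uniform in
`j < N m` and geometric in `m`. -/
def pairWeight (N : ℕ → ℕ) (u : ℕ) : ℝ≥0∞ :=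
  if u.unpair.2 < N u.unpair.1 then (2⁻¹ : ℝ≥0∞) ^ (u.unpair.1 + 1) * (N u.unpair.1 : ℝ≥0∞)⁻¹
  else 0

theorem tsum_pairWeight_le_one (N : ℕ → ℕ) : ∑' u, pairWeight N u ≤ 1 := by
  have h := Nat.pairEquiv.symm.tsum_eq (fun p : ℕ × ℕ => if p.2 < N p.1 then
    (2⁻¹ : ℝ≥0∞) ^ (p.1 + 1) * (N p.1 : ℝ≥0∞)⁻¹ else 0)
  have h' : ∑' u, pairWeight N u = ∑' p : ℕ × ℕ, if p.2 < N p.1 then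
    (2⁻¹ : ℝ≥0∞) ^ (p.1 + 1) * (N p.1 : ℝ≥0∞)⁻¹ else 0 := h
  rw [h', ENNReal.tsum_prod']
  calc ∑' (m : ℕ) (j : ℕ), (if j < N m then (2⁻¹ : ℝ≥0∞) ^ (m + 1) * (N m : ℝ≥0∞)⁻¹ else 0)
      ≤ ∑' m : ℕ, (2⁻¹ : ℝ≥0∞) ^ (m + 1) := by
        refine ENNReal.tsum_le_tsum fun m => ?_
        rw [tsum_eq_sum (s := Finset.range (N m)) fun j hj =>
          if_neg (by simpa using hj), Finset.sum_congr rfl fun j hj =>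
          if_pos (Finset.mem_range.1 hj), Finset.sum_const, Finset.card_range, nsmul_eq_mul,
          mul_left_comm]
        exact mul_le_of_le_one_right' (ENNReal.mul_inv_le_one _)
    _ = 1 := by
        rw [ENNReal.tsum_geometric_add_one, ENNReal.one_sub_inv_two, inv_inv,
          ENNReal.inv_mul_cancel (by simp) (by simp)]

/-- The cost is at most `(m + 1) + α * (m + 1)`, and `m + 1 ≤ 2 * m` makes it proportional to `m`.
-/
theorem le_pairWeight {N : ℕ → ℕ} {α : ℝ} (hα : 0 ≤ α)
    (hN : ∀ m, (N m : ℝ) ≤ Real.exp (α * (m + 1))) {m j : ℕ} (hm : 1 ≤ m) (hj : j < N m) :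
    ENNReal.ofReal (Real.exp (-(2 * (α + 1) * m))) ≤ pairWeight N (Nat.pair m j) := by
  simp only [pairWeight, Nat.unpair_pair, hj, if_true]
  have hN0 : (0 : ℝ) < N m := by exact_mod_cast (Nat.zero_le j).trans_lt hj
  have hm' : (1 : ℝ) ≤ m := by exact_mod_cast hm
  have e1 : (2⁻¹ : ℝ≥0∞) ^ (m + 1) * (N m : ℝ≥0∞)⁻¹ =
      ENNReal.ofReal ((2⁻¹ : ℝ) ^ (m + 1) * (N m : ℝ)⁻¹) := by
    rw [ENNReal.ofReal_mul (by positivity), ENNReal.ofReal_pow (by positivity),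
      ENNReal.ofReal_inv_of_pos two_pos, ENNReal.ofReal_inv_of_pos hN0, ENNReal.ofReal_natCast,
      ENNReal.ofReal_ofNat]
  rw [e1]
  refine ENNReal.ofReal_le_ofReal ?_
  have h1 : Real.exp (-((m + 1 : ℕ) : ℝ)) ≤ (2⁻¹ : ℝ) ^ (m + 1) := by
    rw [inv_pow, Real.exp_neg]
    refine inv_anti₀ (by positivity) ?_
    rw [← mul_one ((m + 1 : ℕ) : ℝ), Real.exp_nat_mul]
    refine pow_le_pow_left₀ (by norm_num) ?_ _
    have := Real.add_one_le_exp 1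
    linarith
  have h2 : Real.exp (-(α * (m + 1))) ≤ (N m : ℝ)⁻¹ := by
    rw [Real.exp_neg]
    exact inv_anti₀ hN0 (hN m)
  refine le_trans ?_ (mul_le_mul h1 h2 (Real.exp_pos _).le (by positivity))
  rw [← Real.exp_add]
  refine Real.exp_le_exp.2 ?_
  push_cast
  nlinarith

/-- Given countably many labels on `K` whose complexity is controlled by an integrable function
`τ`, there are a finite partition `P` and a countable labelling `b` which together determine these
labels, such that `b` has small conditional information given `P`. -/
theorem exists_partition_small_conditional_info {X : Type*} [MeasurableSpace X] {μ : Measure X}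
    [IsFiniteMeasure μ] {K : Set X} (hK : MeasurableSet K) {τ : X → ℕ} (hτ : Measurable τ)
    (hτK : ∫⁻ x in K, (τ x : ℝ≥0∞) ∂μ ≠ ⊤) {l : ℕ → X → ℕ} (hl : ∀ m, Measurable (l m))
    {N : ℕ → ℕ} (hlN : ∀ m x, l m x < N m) {α : ℝ} (hα : 0 ≤ α)
    (hN : ∀ m, (N m : ℝ) ≤ Real.exp (α * (m + 1))) {η : ℝ} (hη : 0 < η) :
    ∃ (k : ℕ) (P : FinMeasurablePartition X k) (b : X → ℕ) (ρ : Fin k → ℕ → ℝ≥0∞) (g : X → ℝ),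
      (∀ v, ∑' u, ρ v u ≤ 1) ∧ Measurable g ∧ (∀ x, 0 ≤ g x) ∧
      ∫⁻ x, ENNReal.ofReal (g x) ∂μ ≤ ENNReal.ofReal η ∧
      (∀ x, ENNReal.ofReal (Real.exp (-g x)) ≤ ρ (P.label x) (b x)) ∧
      ∀ x y, P.label y = P.label x → b y = b x → x ∈ K →
        y ∈ K ∧ τ y = τ x ∧ l (τ x) y = l (τ x) x := by
  classical
  let γ : ℝ := 2 * (α + 1)
  have hγ : 0 < γ := by positivity
  -- Absolute continuity of the integral. The rate `γ` is the one in `le_pairWeight`, so the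
  -- residual labels will cost at most `η` on average.
  obtain ⟨m₀, hm₀⟩ : ∃ m₀ : ℕ, ∫⁻ x in {x | m₀ < τ x} ∩ K, (τ x : ℝ≥0∞) ∂μ ≤
      ENNReal.ofReal (η / γ) := by
    have hS : ∀ m₀, MeasurableSet {x | m₀ < τ x} := fun m₀ => measurableSet_lt measurable_const hτ
    have hlim : Tendsto (fun m₀ : ℕ => μ.restrict K {x | m₀ < τ x}) atTop (𝓝 0) := by
      have h := tendsto_measure_iInter_atTop (μ := μ.restrict K) (s := fun m₀ => {x | m₀ < τ x})
        (fun m₀ => (hS m₀).nullMeasurableSet)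
        (fun i j hij x hx => lt_of_le_of_lt hij hx) ⟨0, measure_ne_top _ _⟩
      have h0 : ⋂ m₀, {x | m₀ < τ x} = ∅ := by
        refine Set.eq_empty_of_forall_notMem fun x hx => ?_
        exact lt_irrefl (τ x) (show τ x < τ x from mem_iInter.1 hx (τ x))
      rwa [h0, measure_empty] at h
    have h := tendsto_setLIntegral_zero hτK hlim
    obtain ⟨m₀, hm₀⟩ := (h.eventually (gt_mem_nhds (ENNReal.ofReal_pos.2
      (div_pos hη hγ)))).exists
    refine ⟨m₀, ?_⟩
    rw [← Measure.restrict_restrict (hS m₀)]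
    exact hm₀.le
  let S : Set X := {x | m₀ < τ x} ∩ K
  have hS : MeasurableSet S := (measurableSet_lt measurable_const hτ).inter hK
  let p : X → ℕ := fun x => Nat.pair (τ x) (l (τ x) x)
  have hp : Measurable p :=
    (Measurable.of_discrete (f := fun q : ℕ × ℕ => Nat.pair q.1 q.2)).comp
      (hτ.prodMk (measurable_apply_index hτ hl))
  -- Bounded `τ` leaves finitely many pairs, which go into the finite partition. All of `S` is one
  -- atom, the only one on which `b` carries information.
  let c : X → ℕ := fun x => if x ∈ K then (if x ∈ S then 1 else 2 + p x) else 0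
  have hcm : Measurable c :=
    Measurable.ite hK (Measurable.ite hS measurable_const (hp.const_add 2)) measurable_const
  let M : ℕ := m₀ + ∑ m ∈ Finset.range (m₀ + 1), N m + 1
  have hck : ∀ x, c x < 3 + M ^ 2 := by
    intro x
    by_cases hx : x ∈ K
    · by_cases hxS : x ∈ S
      · simp only [c, hx, hxS, if_true]
        omega
      · simp only [c, hx, hxS, if_true, if_false]
        have hτx : τ x ≤ m₀ := not_lt.1 fun h => hxS ⟨h, hx⟩
        have h1 : N (τ x) ≤ ∑ m ∈ Finset.range (m₀ + 1), N m :=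
          Finset.single_le_sum (fun _ _ => Nat.zero_le _) (Finset.mem_range.2 (by omega))
        have h2 := hlN (τ x) x
        have h3 : p x < M ^ 2 := by
          refine (Nat.pair_lt_max_add_one_sq _ _).trans_le (Nat.pow_le_pow_left ?_ 2)
          simp only [M]
          omega
        omega
    · simp only [c, hx, if_false]
      omega
  let b : X → ℕ := fun x => if x ∈ S then p x else 0
  let g : X → ℝ := S.indicator fun x => γ * τ x
  have hlabel := FinMeasurablePartition.label_ofFibers hcm hck
  have hc1 : ∀ x, c x = 1 ↔ x ∈ S := by
    intro x
    by_cases hx : x ∈ K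
    · by_cases hxS : x ∈ S
      · simp [c, hx, hxS]
      · simp only [c, hx, hxS, if_true, if_false, iff_false]
        omega
    · have : x ∉ S := fun h => hx h.2
      simp [c, hx, this]
  refine ⟨_, FinMeasurablePartition.ofFibers hcm hck, b,
    fun v u => if (v : ℕ) = 1 then pairWeight N u else if u = 0 then 1 else 0, g, ?_, ?_, ?_, ?_,
    ?_, ?_⟩
  · intro v
    by_cases hv : (v : ℕ) = 1
    · simp only [hv, if_true]
      exact tsum_pairWeight_le_one N
    · simp only [hv, if_false, tsum_ite_eq, le_refl]
  · exact ((measurable_from_top.comp hτ).const_mul γ).indicator hS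
  · exact fun x => indicator_nonneg (fun x _ => by positivity) x
  · have h1 : (fun x => ENNReal.ofReal (g x)) =
        S.indicator fun x => ENNReal.ofReal γ * (τ x : ℝ≥0∞) := by
      ext x
      by_cases hx : x ∈ S
      · simp only [g, indicator_of_mem hx]
        rw [ENNReal.ofReal_mul hγ.le, ENNReal.ofReal_natCast]
      · simp only [g, indicator_of_notMem hx, ENNReal.ofReal_zero]
    rw [h1, lintegral_indicator hS, lintegral_const_mul' _ _ ENNReal.ofReal_ne_top]
    calc ENNReal.ofReal γ * ∫⁻ x in S, (τ x : ℝ≥0∞) ∂μ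
        ≤ ENNReal.ofReal γ * ENNReal.ofReal (η / γ) := by gcongr
      _ = ENNReal.ofReal η := by
          rw [← ENNReal.ofReal_mul hγ.le, mul_div_cancel₀ _ hγ.ne']
  · intro x
    simp only [hlabel]
    by_cases hx : x ∈ S
    · simp only [(hc1 x).2 hx, if_true, b, hx, g, indicator_of_mem hx]
      exact le_pairWeight hα hN (Nat.one_le_iff_ne_zero.2 fun h => by
        have := hx.1
        simp only [mem_ofPred_eq] at this
        omega) (hlN _ _)
    · simp [hc1 x, hx, b, g]
  · intro x y hxy hb hxK
    have hcxy : c y = c x := by rw [← hlabel, ← hlabel, hxy]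
    have hyK : y ∈ K := by
      by_contra hy
      have h1 : c y = 0 := by simp [c, hy]
      have h2 : c x ≠ 0 := by
        simp only [c, hxK, if_true]
        split_ifs <;> omega
      exact h2 (hcxy ▸ h1)
    have hSS : y ∈ S ↔ x ∈ S := by rw [← hc1, ← hc1, hcxy]
    have hpp : p y = p x := by
      by_cases hxS : x ∈ S
      · simpa only [b, hxS, hSS.2 hxS, if_true] using hb
      · have hyS : y ∉ S := fun h => hxS (hSS.1 h)
        simp only [c, hxK, hyK, hxS, hyS, if_true, if_false] at hcxy
        omega
    obtain ⟨h1, h2⟩ := Nat.pair_eq_pair.1 hpp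
    exact ⟨hyK, h1, by rw [← h2, h1]⟩

end Partition

/-! ### Local entropy is at most the entropy -/

section UpperBound

/-- A Fatou-type ergodic inequality for sequences with `G n (T x) ≤ G (n + 1) x`. -/
theorem Ergodic.ae_frequently_le_mul {X : Type*} [MeasurableSpace X] {μ : Measure X}
    [IsProbabilityMeasure μ] {T : X → X} (hT : Ergodic T μ) {G : ℕ → X → ℝ}
    (hG : ∀ n, Measurable (G n)) (hGT : ∀ᵐ x ∂μ, ∀ n, G n (T x) ≤ G (n + 1) x)
    {β β' : ℝ} (hβ : 0 ≤ β) (hββ' : β < β')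
    (hint : ∀ᶠ n : ℕ in atTop, ∫⁻ x, ENNReal.ofReal (G n x) ∂μ ≤ ENNReal.ofReal (n * β)) :
    ∀ᵐ x ∂μ, ∃ᶠ n : ℕ in atTop, G n x ≤ n * β' := by
  let Φ : X → ℝ≥0∞ := fun x => liminf (fun n : ℕ => ENNReal.ofReal (G n x / n)) atTop
  have hmeas : ∀ n : ℕ, Measurable fun x => ENNReal.ofReal (G n x / n) := fun n =>
    ((hG n).div_const _).ennreal_ofReal
  have hΦ : Measurable Φ := Measurable.liminf hmeas
  have hΦT : ∀ᵐ x ∂μ, Φ (T x) ≤ Φ x := by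
    filter_upwards [hGT] with x hx
    -- Shifting the index costs the factor `(n + 1) / n`, which tends to `1`.
    have h1 : Φ (T x) ≤ liminf ((fun n : ℕ => ENNReal.ofReal (((n + 1 : ℕ) : ℝ) / n)) *
        fun n : ℕ => ENNReal.ofReal (G (n + 1) x / (n + 1 : ℕ))) atTop := by
      refine liminf_le_liminf ?_
      filter_upwards [eventually_ge_atTop 1] with n hn
      have hn' : (0 : ℝ) < n := by exact_mod_cast hn
      rw [Pi.mul_apply, ← ENNReal.ofReal_mul (by positivity)]
      refine ENNReal.ofReal_le_ofReal ?_
      have : ((n + 1 : ℕ) : ℝ) / n * (G (n + 1) x / (n + 1 : ℕ)) = G (n + 1) x / n := by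
        field_simp
      rw [this]
      exact div_le_div_of_nonneg_right (hx n) hn'.le
    have h2 : limsup (fun n : ℕ => ENNReal.ofReal (((n + 1 : ℕ) : ℝ) / n)) atTop = 1 := by
      refine Tendsto.limsup_eq ?_
      rw [← ENNReal.ofReal_one]
      refine (ENNReal.continuous_ofReal.tendsto 1).comp ?_
      have h3 : Tendsto (fun n : ℕ => 1 + 1 / (n : ℝ)) atTop (𝓝 1) := by
        simpa using (tendsto_const_div_atTop_nhds_zero_nat (1 : ℝ)).const_add 1
      refine h3.congr' ?_
      filter_upwards [eventually_ge_atTop 1] with n hn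
      have hn' : (0 : ℝ) < n := by exact_mod_cast hn
      push_cast
      field_simp
    have h3 := ENNReal.liminf_mul_le
      (u := fun n : ℕ => ENNReal.ofReal (((n + 1 : ℕ) : ℝ) / n))
      (v := fun n : ℕ => ENNReal.ofReal (G (n + 1) x / (n + 1 : ℕ))) (f := atTop)
      (Or.inl (by rw [h2]; exact one_ne_zero)) (Or.inl (by rw [h2]; exact ENNReal.one_ne_top))
    rw [h2, one_mul] at h3
    refine (h1.trans h3).trans (le_of_eq ?_)
    exact liminf_nat_add (fun n : ℕ => ENNReal.ofReal (G n x / n)) 1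
  have hΦint : ∫⁻ x, Φ x ∂μ ≤ ENNReal.ofReal β := by
    refine (lintegral_liminf_le hmeas).trans ?_
    refine liminf_le_of_frequently_le' (Eventually.frequently ?_)
    filter_upwards [hint, eventually_ge_atTop 1] with n hn hn1
    have hn' : (0 : ℝ) < n := by exact_mod_cast hn1
    simp_rw [ENNReal.ofReal_div_of_pos hn', div_eq_mul_inv]
    rw [lintegral_mul_const _ (hG n).ennreal_ofReal, ← div_eq_mul_inv]
    refine (ENNReal.div_le_div_right hn _).trans (le_of_eq ?_)
    rw [← ENNReal.ofReal_div_of_pos hn', mul_div_cancel_left₀ _ hn'.ne']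
  filter_upwards [hT.ae_le_of_comp_le_of_lintegral_le hΦ hΦT hΦint] with x hx
  have hlt : Φ x < ENNReal.ofReal β' :=
    hx.trans_lt ((ENNReal.ofReal_lt_ofReal_iff (hβ.trans_lt hββ')).2 hββ')
  refine ((frequently_lt_of_liminf_lt (by isBoundedDefault) hlt).and_eventually
    (eventually_ge_atTop 1)).mono ?_
  rintro n ⟨hn, hn1⟩
  have hn' : (0 : ℝ) < n := by exact_mod_cast hn1
  have := (ENNReal.ofReal_lt_ofReal_iff (hβ.trans_lt hββ')).1 hn
  rw [div_lt_iff₀ hn'] at this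
  linarith

namespace FinMeasurablePartition

variable {X : Type*} [MeasurableSpace X] {k : ℕ}

theorem measurable_word (P : FinMeasurablePartition X k) {T : X → X} (hT : Measurable T) (n : ℕ) :
    Measurable (P.word T n) := by
  refine measurable_to_countable' fun w => ?_
  have : P.word T n ⁻¹' {w} = refinedAtom T P n w := by
    ext x
    exact P.mem_refinedAtom_iff.symm
  rw [this]
  exact measurableSet_refinedAtom hT P n w

/-- The information `-log μ(𝒫ⁿ(x))`. -/
def info (P : FinMeasurablePartition X k) (μ : Measure X) (T : X → X) (n : ℕ) (x : X) : ℝ :=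
  -Real.log (μ.real (refinedAtom T P n (P.word T n x)))

theorem info_nonneg (P : FinMeasurablePartition X k) (μ : Measure X) [IsProbabilityMeasure μ]
    (T : X → X) (n : ℕ) (x : X) : 0 ≤ P.info μ T n x :=
  neg_nonneg.2 (Real.log_nonpos measureReal_nonneg measureReal_le_one)

theorem measurable_info (P : FinMeasurablePartition X k) (μ : Measure X) {T : X → X}
    (hT : Measurable T) (n : ℕ) : Measurable (P.info μ T n) :=
  (Measurable.of_discrete (f := fun w => -Real.log (μ.real (refinedAtom T P n w)))).comp
    (P.measurable_word hT n)

theorem lintegral_info (P : FinMeasurablePartition X k) (μ : Measure X) [IsProbabilityMeasure μ]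
    {T : X → X} (hT : Measurable T) (n : ℕ) :
    ∫⁻ x, ENNReal.ofReal (P.info μ T n x) ∂μ = ENNReal.ofReal (refinedEntropy μ T P n) := by
  rw [← setLIntegral_univ, ← iUnion_refinedAtom T P n,
    lintegral_iUnion (measurableSet_refinedAtom hT P n) (refinedAtom_disjoint T P n), tsum_fintype,
    refinedEntropy, ENNReal.ofReal_sum_of_nonneg fun w _ =>
      Real.negMulLog_nonneg measureReal_nonneg measureReal_le_one]
  refine Finset.sum_congr rfl fun w _ => ?_
  calc ∫⁻ x in refinedAtom T P n w, ENNReal.ofReal (P.info μ T n x) ∂μ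
      = ∫⁻ _ in refinedAtom T P n w,
          ENNReal.ofReal (-Real.log (μ.real (refinedAtom T P n w))) ∂μ := by
        refine setLIntegral_congr_fun (measurableSet_refinedAtom hT P n w) fun x hx => ?_
        simp only [info, P.mem_refinedAtom_iff.1 hx]
    _ = _ := by
        rw [setLIntegral_const, ← ofReal_measureReal, ← ENNReal.ofReal_mul
          (neg_nonneg.2 (Real.log_nonpos measureReal_nonneg measureReal_le_one)),
          Real.negMulLog]
        congr 1
        ring

theorem ae_forall_refinedAtom_pos (P : FinMeasurablePartition X k) (μ : Measure X) (T : X → X) :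
    ∀ᵐ x ∂μ, ∀ n, 0 < μ (refinedAtom T P n (P.word T n x)) := by
  refine ae_all_iff.2 fun n => ?_
  have h : ∀ w, ∀ᵐ x ∂μ, P.word T n x = w → 0 < μ (refinedAtom T P n w) := by
    intro w
    rcases eq_or_ne (μ (refinedAtom T P n w)) 0 with h0 | h0
    · filter_upwards [measure_eq_zero_iff_ae_notMem.1 h0] with x hx hw
      exact absurd (P.mem_refinedAtom_iff.2 hw) hx
    · exact Eventually.of_forall fun x _ => pos_iff_ne_zero.2 h0
  filter_upwards [ae_all_iff.2 h] with x hx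
  exact hx _ rfl

/-- Dropping the first symbol enlarges the cylinder. Positivity is required because `Real.log 0 = 0`
would break monotonicity. -/
theorem info_apply_le (P : FinMeasurablePartition X k) {μ : Measure X} [IsProbabilityMeasure μ]
    {T : X → X} (hT : MeasurePreserving T μ μ) {n : ℕ} {x : X}
    (hx : 0 < μ (refinedAtom T P (n + 1) (P.word T (n + 1) x))) :
    P.info μ T n (T x) ≤ P.info μ T (n + 1) x := by
  have hsub : refinedAtom T P (n + 1) (P.word T (n + 1) x) ⊆
      T ⁻¹' refinedAtom T P n (P.word T n (T x)) := by
    intro y hy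
    rw [P.mem_refinedAtom_iff] at hy
    rw [mem_preimage, P.mem_refinedAtom_iff]
    ext1 i
    have := congrFun hy i.succ
    simpa [word, Function.iterate_succ_apply] using this
  have h1 : μ.real (refinedAtom T P (n + 1) (P.word T (n + 1) x)) ≤
      μ.real (refinedAtom T P n (P.word T n (T x))) := by
    rw [← hT.measureReal_preimage (measurableSet_refinedAtom hT.measurable P n _).nullMeasurableSet]
    exact measureReal_mono hsub
  exact neg_le_neg (Real.log_le_log (ENNReal.toReal_pos hx.ne' (measure_ne_top _ _)) h1)

end FinMeasurablePartition

theorem ballDecay_le_of_frequently {X : Type*} [MetricSpace X] [MeasurableSpace X] {μ : Measure X}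
    [IsFiniteMeasure μ] {T : X → X} {x : X} {r c : ℝ}
    (h : ∃ᶠ n : ℕ in atTop, Real.exp (-(n * c)) ≤ μ.real (dynBall T n x r)) :
    ballDecay μ T x r ≤ c := by
  refine liminf_le_of_frequently_le' ((h.and_eventually (eventually_ge_atTop 1)).mono ?_)
  rintro n ⟨hn, hn1⟩
  have hn0 : (0 : EReal) < (n : EReal) := by exact_mod_cast hn1
  have h1 : ENNReal.ofReal (Real.exp (-(n * c))) ≤ μ (dynBall T n x r) := by
    rw [← ofReal_measureReal]
    exact ENNReal.ofReal_le_ofReal hn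
  have h2 := ENNReal.log_monotone h1
  rw [ENNReal.log_ofReal_of_pos (Real.exp_pos _), Real.log_exp] at h2
  have h3 : ((-c : ℝ) : EReal) ≤ ENNReal.log (μ (dynBall T n x r)) / (n : EReal) := by
    rw [EReal.le_div_iff_mul_le hn0 (EReal.natCast_ne_top n)]
    refine le_trans (le_of_eq ?_) h2
    norm_cast
    ring_nf
  have h4 := EReal.neg_le_neg_iff.2 h3
  rwa [← EReal.coe_neg, neg_neg] at h4

/-- If, at each visit of the orbit of `x` to `K`, the orbit of `y` is close at a scale which
compensates the expansion until the next visit, then `y` lies in the dynamical ball of `x`. -/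
theorem mem_dynBall_of_close_at_visits {X : Type*} [MetricSpace X] {T : X → X} {C : ℝ≥0}
    (hT : LipschitzWith C T) (hC : 1 ≤ C) {K : Set X} {x y : X} (hx : x ∈ K)
    (hret : ∀ j, T^[j] x ∈ K → ∃ m, 1 ≤ m ∧ T^[m] (T^[j] x) ∈ K) {n : ℕ} {r : ℝ}
    (hclose : ∀ i < n, T^[i] x ∈ K →
      dist (T^[i] x) (T^[i] y) * (C : ℝ) ^ returnTime T K (T^[i] x) < r) :
    y ∈ dynBall T n x r := by
  classical
  intro i hi
  -- The last visit to `K` up to time `i`, which exists since `x ∈ K`. The next return is not before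
  -- `i`, so the expansion since time `j` is covered by the scale chosen there.
  let j := Nat.findGreatest (fun j => T^[j] x ∈ K) i
  have hj : T^[j] x ∈ K :=
    Nat.findGreatest_spec (P := fun j => T^[j] x ∈ K) (Nat.zero_le i) hx
  have hji : j ≤ i := Nat.findGreatest_le i
  obtain ⟨hτ1, hτK⟩ := iterate_returnTime_mem (hret j hj)
  have hlt : i - j ≤ returnTime T K (T^[j] x) := by
    by_contra! hcon
    rw [← Function.iterate_add_apply] at hτK
    exact Nat.findGreatest_is_greatest (P := fun j => T^[j] x ∈ K) (n := i)
      (k := returnTime T K (T^[j] x) + j) (by omega) (by omega) hτK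
  have hC' : (1 : ℝ) ≤ C := by exact_mod_cast hC
  have e : ∀ z, T^[i] z = T^[i - j] (T^[j] z) := fun z => by
    rw [← Function.iterate_add_apply, Nat.sub_add_cancel hji]
  calc dist (T^[i] x) (T^[i] y) ≤ (C : ℝ) ^ (i - j) * dist (T^[j] x) (T^[j] y) := by
        rw [e x, e y]
        simpa using (hT.iterate (i - j)).dist_le_mul (T^[j] x) (T^[j] y)
    _ ≤ (C : ℝ) ^ returnTime T K (T^[j] x) * dist (T^[j] x) (T^[j] y) := by
        gcongr
    _ < r := by
        rw [mul_comm]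
        exact hclose j (hji.trans_lt hi) hj

/-- On a set `K` with polynomially growing covering numbers, the decay rate of the measure of
dynamical balls is at most the measure-theoretic entropy. -/
theorem ae_ballDecay_le_of_measureEntropy_lt {X : Type*} [MetricSpace X] [MeasurableSpace X]
    [BorelSpace X] {T : X → X} {C : ℝ≥0} (hTC : LipschitzWith C T)
    {μ : Measure X} [IsProbabilityMeasure μ] (hT : Ergodic T μ) {K : Set X}
    (hK : MeasurableSet K) {D : ℕ} (hKD : HasPolynomialCover D K) {r : ℝ} (hr : 0 < r) {z δ : ℝ}
    (hz : measureEntropy μ T < z) (hδ : 0 < δ) :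
    ∀ᵐ x ∂μ, x ∈ K → ballDecay μ T x r ≤ ((z + 3 * δ : ℝ) : EReal) := by
  have hne : Nonempty X := μ.nonempty_of_neZero
  have hTp : MeasurePreserving T μ μ := hT.toMeasurePreserving
  have hTm : Measurable T := hTp.measurable
  have hC1 : 1 ≤ max C 1 := le_max_right _ _
  have hTC' : LipschitzWith (max C 1) T := hTC.weaken (le_max_left _ _)
  obtain ⟨α, l, N, hα, hl, hlN, hN, hclose⟩ :=
    hKD.exists_label (C := (max C 1 : ℝ≥0)) (by exact_mod_cast hC1) hr
  obtain ⟨k, P, b, ρ, g, hρ, hgm, hg0, hgi, hgρ, hlab⟩ :=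
    exists_partition_small_conditional_info hK (measurable_returnTime hTm hK)
      (ne_top_of_le_ne_top ENNReal.one_ne_top (setLIntegral_returnTime_le_one hTp hK))
      hl hlN hα hN hδ
  have hHz : ∀ᶠ n : ℕ in atTop, refinedEntropy μ T P n / n < z := by
    have h1 : partitionEntropy μ T P < z :=
      (le_iSup₂ (f := fun (k : ℕ) (P : FinMeasurablePartition X k) => partitionEntropy μ T P)
        k P).trans_lt hz
    filter_upwards [eventually_lt_of_limsup_lt h1 (by isBoundedDefault)] with n hn
    exact EReal.coe_lt_coe_iff.1 hn
  have hH0 : ∀ n, 0 ≤ refinedEntropy μ T P n := fun n => Finset.sum_nonneg fun w _ =>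
    Real.negMulLog_nonneg measureReal_nonneg measureReal_le_one
  have hz0 : 0 ≤ z := by
    obtain ⟨n, hn⟩ := hHz.exists
    exact (div_nonneg (hH0 n) (Nat.cast_nonneg n)).trans hn.le
  let S : ℕ → X → ℝ := birkhoffSum T g
  have hS0 : ∀ n x, 0 ≤ S n x := fun n x => Finset.sum_nonneg fun i _ => hg0 _
  have hSm : ∀ n, Measurable (S n) := fun n =>
    Finset.measurable_fun_sum _ fun i _ => hgm.comp (hTm.iterate i)
  -- Total information of the joint itinerary. The three `δ` are spent on the mean of `g`, on the
  -- strict gap in `Ergodic.ae_frequently_le_mul`, and on Borel–Cantelli.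
  let G : ℕ → X → ℝ := fun n x => P.info μ T n x + S n x
  have hfreq : ∀ᵐ x ∂μ, ∃ᶠ n : ℕ in atTop, G n x ≤ n * (z + 2 * δ) := by
    refine hT.ae_frequently_le_mul (β := z + δ) (fun n => (P.measurable_info μ hTm n).add (hSm n))
      ?_ (by linarith) (by linarith) ?_
    · filter_upwards [P.ae_forall_refinedAtom_pos μ T] with x hx n
      refine add_le_add (P.info_apply_le hTp (hx _)) ?_
      simp only [S]
      rw [birkhoffSum_succ']
      linarith [hg0 x]
    · filter_upwards [hHz, eventually_ge_atTop 1] with n hn hn1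
      have hn' : (0 : ℝ) < n := by exact_mod_cast hn1
      rw [div_lt_iff₀ hn'] at hn
      have hSi : ∫⁻ x, ENNReal.ofReal (S n x) ∂μ ≤ ENNReal.ofReal (n * δ) := by
        have h1 : ∀ x, ENNReal.ofReal (S n x) =
            ∑ i ∈ Finset.range n, ENNReal.ofReal (g (T^[i] x)) := fun x =>
          ENNReal.ofReal_sum_of_nonneg fun i _ => hg0 _
        simp_rw [h1]
        rw [lintegral_finsetSum (f := fun i x => ENNReal.ofReal (g (T^[i] x))) _
          fun i _ => (hgm.comp (hTm.iterate i)).ennreal_ofReal]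
        have h2 : ∀ i, ∫⁻ x, ENNReal.ofReal (g (T^[i] x)) ∂μ = ∫⁻ x, ENNReal.ofReal (g x) ∂μ :=
          fun i => (hTp.iterate i).lintegral_comp hgm.ennreal_ofReal
        simp_rw [h2]
        rw [Finset.sum_const, Finset.card_range, nsmul_eq_mul, ENNReal.ofReal_mul hn'.le,
          ENNReal.ofReal_natCast]
        gcongr
      have hGadd : ∀ x, ENNReal.ofReal (G n x) =
          ENNReal.ofReal (P.info μ T n x) + ENNReal.ofReal (S n x) := fun x =>
        ENNReal.ofReal_add (P.info_nonneg μ T n x) (hS0 n x)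
      refine (lintegral_congr hGadd).trans_le ?_
      rw [lintegral_add_left (P.measurable_info μ hTm n).ennreal_ofReal, P.lintegral_info μ hTm]
      refine (add_le_add_right hSi _).trans ?_
      rw [← ENNReal.ofReal_add (hH0 n) (by positivity)]
      refine ENNReal.ofReal_le_ofReal ?_
      linarith
  filter_upwards [hfreq, P.ae_forall_refinedAtom_pos μ T, ae_forall_exists_return hTp hK,
    ae_eventually_weight_le μ hTm P b ρ hρ hδ] with x hx hpos hret hev hxK
  refine ballDecay_le_of_frequently ((hx.and_eventually hev).mono ?_)
  rintro n ⟨hn1, hn2⟩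
  have hsub : {y | P.word T n y = P.word T n x ∧ ∀ i < n, b (T^[i] y) = b (T^[i] x)} ⊆
      dynBall T n x r := by
    rintro y ⟨hy1, hy2⟩
    refine mem_dynBall_of_close_at_visits hTC' hC1 hxK hret fun i hi hiK => ?_
    obtain ⟨h1, -, h3⟩ := hlab (T^[i] x) (T^[i] y) (congrFun hy1 ⟨i, hi⟩) (hy2 i hi) hiK
    exact hclose _ _ hiK _ h1 h3.symm
  have hlow : ENNReal.ofReal (Real.exp (-(n * δ + G n x))) ≤ μ (dynBall T n x r) := by
    refine le_trans ?_ (hn2.trans (measure_mono hsub))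
    have hI : μ (refinedAtom T P n (P.word T n x)) =
        ENNReal.ofReal (Real.exp (-P.info μ T n x)) := by
      have hreal : 0 < μ.real (refinedAtom T P n (P.word T n x)) :=
        ENNReal.toReal_pos (hpos n).ne' (measure_ne_top _ _)
      rw [FinMeasurablePartition.info, neg_neg, Real.exp_log hreal, ofReal_measureReal]
    have hSexp : ENNReal.ofReal (Real.exp (-S n x)) ≤
        ∏ i : Fin n, ρ (P.label (T^[(i : ℕ)] x)) (b (T^[(i : ℕ)] x)) := by
      have : Real.exp (-S n x) = ∏ i : Fin n, Real.exp (-g (T^[(i : ℕ)] x)) := by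
        rw [← Real.exp_sum, Finset.sum_neg_distrib,
          Fin.sum_univ_eq_sum_range (fun i => g (T^[i] x))]
        rfl
      rw [this, ENNReal.ofReal_prod_of_nonneg fun i _ => (Real.exp_pos _).le]
      exact Finset.prod_le_prod' fun i _ => hgρ _
    have hsplit : Real.exp (-(n * δ + G n x)) =
        Real.exp (-(n * δ)) * (Real.exp (-P.info μ T n x) * Real.exp (-S n x)) := by
      rw [← Real.exp_add, ← Real.exp_add]
      congr 1
      simp only [G]
      ring
    rw [hsplit, ENNReal.ofReal_mul (Real.exp_pos _).le, ENNReal.ofReal_mul (Real.exp_pos _).le, hI]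
    gcongr
  refine le_trans (Real.exp_le_exp.2 ?_)
    ((ENNReal.ofReal_le_iff_le_toReal (measure_ne_top _ _)).1 hlow)
  linarith

/-- On a set `K` with polynomially growing covering numbers, the lower local entropy is at most
the measure-theoretic entropy. -/
theorem essSup_lowerLocalEntropy_le_measureEntropy {X : Type*} [MetricSpace X] [MeasurableSpace X]
    [BorelSpace X] {T : X → X} {C : ℝ≥0} (hTC : LipschitzWith C T)
    {μ : Measure X} [IsProbabilityMeasure μ] (hT : Ergodic T μ) {K : Set X}
    (hK : MeasurableSet K) {D : ℕ} (hKD : HasPolynomialCover D K) :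
    essSup (lowerLocalEntropy μ T) (μ.restrict K) ≤ measureEntropy μ T := by
  refine EReal.le_of_forall_lt_iff_le.1 fun z hz => ?_
  refine EReal.le_of_forall_lt_iff_le.1 fun y hy => ?_
  obtain ⟨δ, hδ, rfl⟩ : ∃ δ : ℝ, 0 < δ ∧ y = z + 3 * δ :=
    ⟨(y - z) / 3, by linarith [EReal.coe_lt_coe_iff.1 hy], by ring⟩
  refine essSup_le_of_ae_le _ ((ae_restrict_iff' hK).2 ?_)
  -- The exceptional null set depends on the radius, so only the countably many radii `1 / (n + 1)`
  -- are used.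
  have h := ae_all_iff.2 fun n : ℕ => ae_ballDecay_le_of_measureEntropy_lt hTC hT hK hKD
    (Nat.one_div_pos_of_nat (α := ℝ) (n := n)) hz hδ
  filter_upwards [h] with x hx hxK
  have hlim : Tendsto (fun n : ℕ => 1 / ((n : ℝ) + 1)) atTop (𝓝[>] 0) :=
    tendsto_nhdsWithin_iff.2 ⟨tendsto_one_div_add_atTop_nhds_zero_nat,
      Eventually.of_forall fun n => mem_Ioi.2 Nat.one_div_pos_of_nat⟩
  exact le_of_tendsto' ((tendsto_lowerLocalEntropy μ T x).comp hlim) fun n => hx n hxK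

end UpperBound

end

/-! ### The entropy formula -/

theorem theorem1p3 {d : ℕ} {M : Type*} [MetricSpace M] [CompleteSpace M]
    [ChartedSpace (EuclideanSpace ℝ (Fin d)) M] [IsManifold (𝓡 d) ∞ M]
    [Bundle.RiemannianBundle (fun x : M => TangentSpace (𝓡 d) x)]
    [IsContMDiffRiemannianBundle (𝓡 d) ∞ (EuclideanSpace ℝ (Fin d))
      (fun x : M => TangentSpace (𝓡 d) x)]
    [IsRiemannianManifold (𝓡 d) M]
    [MeasurableSpace M] [BorelSpace M]
    (T : M → M) (C : ℝ≥0) (hT : LipschitzWith C T)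
    (μ : Measure M) [IsProbabilityMeasure μ] (hμ : Ergodic T μ) :
    measureEntropy μ T =
      ⨆ (K : Set M) (_ : IsCompact K) (_ : 0 < μ K),
        essSup (lowerLocalEntropy μ T) (μ.restrict K) := by
  have : IsManifold (𝓡 d) 1 M := IsManifold.of_le (n := ∞) (by simp)
  have : IsContinuousRiemannianBundle (EuclideanSpace ℝ (Fin d))
      (fun x : M => TangentSpace (𝓡 d) x) := by
    obtain ⟨g, hg, h⟩ := IsContMDiffRiemannianBundle.exists_contMDiff (IB := 𝓡 d) (n := ∞)
      (F := EuclideanSpace ℝ (Fin d)) (E := fun x : M => TangentSpace (𝓡 d) x)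
    exact ⟨g, hg.continuous, h⟩
  have : LocallyCompactSpace M := ChartedSpace.locallyCompactSpace (EuclideanSpace ℝ (Fin d)) M
  have : PreconnectedSpace M := preconnectedSpace_of_isRiemannianManifold d M
  have : TopologicalSpace.SeparableSpace M := separableSpace_of_connected_of_locallyCompact M
  have : SecondCountableTopology M := UniformSpace.secondCountable_of_separable M
  refine le_antisymm ?_ ?_
  · refine measureEntropy_le_of_ae_lowerLocalEntropy_le hμ.toMeasurePreserving ?_
    -- Countably many compact sets cover `M`; those of measure zero are absent from the supremum but
    -- are negligible.
    have hn : ∀ n, ∀ᵐ x ∂μ, x ∈ compactCovering M n → lowerLocalEntropy μ T x ≤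
        ⨆ (K : Set M) (_ : IsCompact K) (_ : 0 < μ K),
          essSup (lowerLocalEntropy μ T) (μ.restrict K) := by
      intro n
      have hc := isCompact_compactCovering M n
      rcases eq_or_ne (μ (compactCovering M n)) 0 with h0 | h0
      · filter_upwards [measure_eq_zero_iff_ae_notMem.1 h0] with x hx hxK
        exact absurd hxK hx
      · filter_upwards [(ae_restrict_iff' hc.measurableSet).1
          (ae_le_essSup (f := lowerLocalEntropy μ T))] with x hx hxK
        exact (hx hxK).trans (le_iSup_of_le _ (le_iSup₂_of_le hc (pos_iff_ne_zero.2 h0) le_rfl))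
    filter_upwards [ae_all_iff.2 hn] with x hx
    obtain ⟨n, hxn⟩ := mem_iUnion.1 ((iUnion_compactCovering M).symm ▸ mem_univ x)
    exact hx n hxn
  · refine iSup_le fun K => iSup₂_le fun hK _ => ?_
    exact essSup_lowerLocalEntropy_le_measureEntropy hT hμ hK.measurableSet
      (hK.hasPolynomialCover_of_isRiemannianManifold (d := d))
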